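/- Let $N\in\{2,3\}$, let $\beta\in\mathbb C$ be a primitive $N$-th root of unity, and consider the autonomous discrete equation $$(u_{n,m+1}+1)(u_{n,m}-1)=\beta\,(u_{n+1,m+1}-1)(u_{n+1,m}+1),\qquad n,m\in\mathbb Z,\quad(\ast)$$ for $u:\mathbb Z^2\to\mathbb C$. Write $(\ast)$ as $\Phi(u_{n,m},u_{n+1,m},u_{n,m+1},u_{n+1,m+1})=0$, where $\Phi$ is the left-hand side minus the right-hand side. A generalized symmetry of $(\ast)$ of order $\mu\ge 1$ in the $m$-direction is a differential-difference equation $$\partial_t u_{n,m}=h_{n,m}(u_{n,m+\mu},u_{n,m+\mu-1},\ldots,u_{n,m-\mu}),$$ with each $h_{n,m}$ holomorphic on a connected open set $D_{n,m}\subseteq\mathbb C^{2\mu+1}$, such that (i) the compatibility condition $\sum_{i,j\in\{0,1\}}h_{n+i,m+j}\,\dfrac{\partial\Phi}{\partial u_{n+i,m+j}}=0$ holds identically on the solutions of $(\ast)$, that is, at every $(n,m)$ for every solution whose four tuples $(u_{n+i,m+j+\mu},\ldots,u_{n+i,m+j-\mu})$, $i,j\in\{0,1\}$, lie in the domains $D_{n+i,m+j}$;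 it is also required that for every $(n,m)$ there is such a solution along which no partial derivative of $\Phi$ vanishes, so that this condition is not void; (ii) neither $\partial h_{n,m}/\partial u_{n,m+\mu}$ nor $\partial h_{n,m}/\partial u_{n,m-\mu}$ vanishes identically for all $n,m$. The symmetry is called autonomous if $h_{n,m}$ and $D_{n,m}$ do not depend explicitly on $n$ and $m$. Then $(\ast)$ has an autonomous generalized symmetry of order $N$ in the $m$-direction, with $h$ holomorphic on all of $\mathbb C^{2N+1}$, and it has no autonomous generalized symmetry in the $m$-direction of any order $\mu<N$. -/

import Mathlib

/-- The left-hand side `Φ` of an autonomous discrete equation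
`Φ (u_{n,m}, u_{n+1,m}, u_{n,m+1}, u_{n+1,m+1}) = 0` on the square lattice;
the arguments are taken in this order. -/
abbrev QuadFun : Type := ℂ → ℂ → ℂ → ℂ → ℂ

namespace QuadFun

/-- `∂Φ/∂u_{n,m}`. -/
noncomputable def d00 (Φ : QuadFun) (a b c d : ℂ) : ℂ := deriv (fun z => Φ z b c d) a

/-- `∂Φ/∂u_{n+1,m}`. -/
noncomputable def d10 (Φ : QuadFun) (a b c d : ℂ) : ℂ := deriv (fun z => Φ a z c d) b

/-- `∂Φ/∂u_{n,m+1}`. -/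
noncomputable def d01 (Φ : QuadFun) (a b c d : ℂ) : ℂ := deriv (fun z => Φ a b z d) c

/-- `∂Φ/∂u_{n+1,m+1}`. -/
noncomputable def d11 (Φ : QuadFun) (a b c d : ℂ) : ℂ := deriv (fun z => Φ a b c z) d

/-- `u` solves the discrete equation `Φ = 0` at all points of the lattice. -/
def IsSolution (Φ : QuadFun) (u : ℤ → ℤ → ℂ) : Prop :=
  ∀ n m : ℤ, Φ (u n m) (u (n + 1) m) (u n (m + 1)) (u (n + 1) (m + 1)) = 0

/-- A solution along which none of the four partial derivatives of `Φ` vanishes, i.e. along which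
the equation can be solved (locally) for each of the four corner values. -/
def IsRegularSolution (Φ : QuadFun) (u : ℤ → ℤ → ℂ) : Prop :=
  Φ.IsSolution u ∧ ∀ n m : ℤ,
    Φ.d00 (u n m) (u (n + 1) m) (u n (m + 1)) (u (n + 1) (m + 1)) ≠ 0 ∧
    Φ.d10 (u n m) (u (n + 1) m) (u n (m + 1)) (u (n + 1) (m + 1)) ≠ 0 ∧
    Φ.d01 (u n m) (u (n + 1) m) (u n (m + 1)) (u (n + 1) (m + 1)) ≠ 0 ∧
    Φ.d11 (u n m) (u (n + 1) m) (u n (m + 1)) (u (n + 1) (m + 1)) ≠ 0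

end QuadFun

/-- The tuple `(u_{n,m-μ}, …, u_{n,m}, …, u_{n,m+μ})`: the entry with index `k` is
`u_{n,m+k-μ}`. -/
def mWindow (μ : ℕ) (u : ℤ → ℤ → ℂ) (n m : ℤ) : Fin (2 * μ + 1) → ℂ :=
  fun k => u n (m + ((k : ℕ) : ℤ) - (μ : ℤ))

/-- The partial derivative of `f` with respect to its `i`-th variable. -/
noncomputable def partialDeriv {k : ℕ} (f : (Fin k → ℂ) → ℂ) (i : Fin k) (x : Fin k → ℂ) : ℂ :=
  deriv (fun z => f (Function.update x i z)) (x i)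

/-- The four windows entering the compatibility condition at the point `(n, m)` lie in the domains
of definition of the right-hand sides. -/
def WindowsIn (μ : ℕ) (D : ℤ → ℤ → Set (Fin (2 * μ + 1) → ℂ)) (u : ℤ → ℤ → ℂ) (n m : ℤ) : Prop :=
  mWindow μ u n m ∈ D n m ∧
  mWindow μ u (n + 1) m ∈ D (n + 1) m ∧
  mWindow μ u n (m + 1) ∈ D n (m + 1) ∧
  mWindow μ u (n + 1) (m + 1) ∈ D (n + 1) (m + 1)

/-- The differential-difference equation
`∂_t u_{n,m} = h_{n,m} (u_{n,m-μ}, …, u_{n,m+μ})`, where each `h_{n,m}` is a holomorphic function on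
the connected open set `D_{n,m}`, is compatible with the discrete equation `Φ = 0`. -/
structure IsCompatibleM (Φ : QuadFun) (μ : ℕ) (D : ℤ → ℤ → Set (Fin (2 * μ + 1) → ℂ))
    (h : ℤ → ℤ → (Fin (2 * μ + 1) → ℂ) → ℂ) : Prop where
  isOpen : ∀ n m : ℤ, IsOpen (D n m)
  isConnected : ∀ n m : ℤ, IsConnected (D n m)
  holomorphic : ∀ n m : ℤ, DifferentiableOn ℂ (h n m) (D n m)
  /-- The compatibility condition below is not void. -/
  nonvoid : ∀ n m : ℤ, ∃ u : ℤ → ℤ → ℂ, Φ.IsRegularSolution u ∧ WindowsIn μ D u n m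
  /-- The derivative of `Φ` in virtue of `∂_t u = h` vanishes identically on the solutions. -/
  compatible : ∀ u : ℤ → ℤ → ℂ, Φ.IsSolution u → ∀ n m : ℤ, WindowsIn μ D u n m →
    h n m (mWindow μ u n m) *
        Φ.d00 (u n m) (u (n + 1) m) (u n (m + 1)) (u (n + 1) (m + 1)) +
      h (n + 1) m (mWindow μ u (n + 1) m) *
        Φ.d10 (u n m) (u (n + 1) m) (u n (m + 1)) (u (n + 1) (m + 1)) +
      h n (m + 1) (mWindow μ u n (m + 1)) *
        Φ.d01 (u n m) (u (n + 1) m) (u n (m + 1)) (u (n + 1) (m + 1)) +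
      h (n + 1) (m + 1) (mWindow μ u (n + 1) (m + 1)) *
        Φ.d11 (u n m) (u (n + 1) m) (u n (m + 1)) (u (n + 1) (m + 1)) = 0

/-- `∂_t u_{n,m} = h_{n,m} (u_{n,m-μ}, …, u_{n,m+μ})` is a generalized symmetry in the `m`-direction
of order `μ` of `Φ = 0`: it is compatible with `Φ = 0`, one has `μ > 0`, and neither
`∂h_{n,m}/∂u_{n,m+μ}` nor `∂h_{n,m}/∂u_{n,m-μ}` is identically zero for all `n, m`. -/
structure IsGeneralizedSymmetryM (Φ : QuadFun) (μ : ℕ) (D : ℤ → ℤ → Set (Fin (2 * μ + 1) → ℂ))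
    (h : ℤ → ℤ → (Fin (2 * μ + 1) → ℂ) → ℂ) : Prop where
  pos : 0 < μ
  isCompatible : IsCompatibleM Φ μ D h
  depends_top : ∃ n m : ℤ, ∃ x ∈ D n m, partialDeriv (h n m) (Fin.last (2 * μ)) x ≠ 0
  depends_bottom : ∃ n m : ℤ, ∃ x ∈ D n m, partialDeriv (h n m) 0 x ≠ 0

/-- The right-hand sides do not depend explicitly on `n` and `m`. -/
def IsAutonomous {μ : ℕ} (D : ℤ → ℤ → Set (Fin (2 * μ + 1) → ℂ))
    (h : ℤ → ℤ → (Fin (2 * μ + 1) → ℂ) → ℂ) : Prop :=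
  ∀ n m : ℤ, D n m = D 0 0 ∧ Set.EqOn (h n m) (h 0 0) (D 0 0)

/-- The equation
`(u_{n,m+1} + 1) (u_{n,m} - 1) = β (u_{n+1,m+1} - 1) (u_{n+1,m} + 1)`. -/
def betaEquation (β : ℂ) : QuadFun :=
  fun u00 u10 u01 u11 => (u01 + 1) * (u00 - 1) - β * ((u11 - 1) * (u10 + 1))

/-!
Write `A k = (x (k+1) + 1) * (x k - 1)` and `B k = (y (k+1) - 1) * (y k + 1)` for two neighbouring
columns `x = u n ·` and `y = u (n+1) ·`; the equation says `A k = β * B k`.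

**Existence.** Both `x ↦ A` and `y ↦ B` are Miura maps: they send the modified Volterra hierarchy to
the Volterra hierarchy. The `N`-th Volterra flow is homogeneous of degree `N + 1`, so rescaling by
`β` multiplies it by `β ^ (N + 1) = β`, and the two neighbouring columns may evolve by the same
polynomial flow (`isSolution_flow_identity`, with `mVolterra₂_miura` and `mVolterra₃_miura`).

**Absence in lower order.** Every regular finite strip satisfying the equation extends to a global
solution (`Linked.exists_isSolution`), so the compatibility condition holds on an open piece of the
variety of linked windows. Differentiating it in the topmost values shows that `∂h/∂u_{n,m+μ}`,
divided by a suitable product `P` of factors `u ^ 2 - 1`, is a function `g` with `β ^ μ * g x = g y`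
for linked windows (`IsCompatibleM.eventually_fderiv_last`). Moving `y` with `x` fixed, and `x` with
`y` fixed, gives two vector fields that kill `g`; the second one acts near the windows `x`, and the
identity theorem carries its equation to the windows `y`. In the coordinates of `chart` the two
fields are polynomial, and iterated Lie brackets of them span the tangent space
at generic points (`fderiv_eq_zero_of_fieldV_of_fieldW`), hence `g` is constant. As `β ^ μ ≠ 1` for
`0 < μ < N`, the constant is zero, and `∂h/∂u_{n,m+μ}` vanishes identically (`eqOn_zero_of_linked`).

The identity theorem and the existence of higher derivatives are needed for functions of several
complex variables; they are deduced from the one-variable theory.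
-/

open Set Filter Topology Metric

/-! ### Holomorphic functions of several variables -/

/-- Cauchy's estimate for the Fréchet derivative, from the one-variable estimate on complex lines.
The radius is halved so that closed discs stay inside the open ball. -/
theorem norm_fderiv_le_of_forall_ball_norm_le {E : Type*} [NormedAddCommGroup E] [NormedSpace ℂ E]
    {f : E → ℂ} {x : E} {r M : ℝ} (hr : 0 < r) (hf : DifferentiableOn ℂ f (ball x r))
    (hM : ∀ y ∈ ball x r, ‖f y‖ ≤ M) : ‖fderiv ℂ f x‖ ≤ M / (r / 2) := by
  have hM0 : 0 ≤ M := (norm_nonneg _).trans (hM x (mem_ball_self hr))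
  have hd : DifferentiableAt ℂ f x := hf.differentiableAt (ball_mem_nhds x hr)
  refine ContinuousLinearMap.opNorm_le_bound _ (by positivity) fun v => ?_
  rcases eq_or_ne v 0 with rfl | hv
  · simp
  have hv' : 0 < ‖v‖ := norm_pos_iff.2 hv
  have hmem : ∀ t ∈ closedBall (0 : ℂ) (r / 2 / ‖v‖), x + t • v ∈ ball x r := by
    intro t ht
    rw [mem_closedBall, dist_zero_right, le_div_iff₀ hv'] at ht
    rw [mem_ball, dist_eq_norm, add_sub_cancel_left, norm_smul]
    linarith
  have hdl : DifferentiableOn ℂ (fun t : ℂ => f (x + t • v)) (closedBall 0 (r / 2 / ‖v‖)) :=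
    hf.comp (by fun_prop) hmem
  have h1 : HasDerivAt (fun t : ℂ => x + t • v) v 0 := by
    simpa using ((hasDerivAt_id (0 : ℂ)).smul_const v).const_add x
  have h2 : HasFDerivAt f (fderiv ℂ f x) (x + (0 : ℂ) • v) := by simpa using hd.hasFDerivAt
  have h3 := Complex.norm_deriv_le_of_forall_mem_sphere_norm_le (by positivity)
    (hdl.diffContOnCl_ball subset_rfl)
    (fun t ht => hM _ (hmem t (sphere_subset_closedBall ht)))
  rw [show deriv (fun t : ℂ => f (x + t • v)) 0 = fderiv ℂ f x v from
    (h2.comp_hasDerivAt 0 h1).deriv] at h3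
  exact h3.trans_eq (by field_simp)

/-- Directional derivatives of a holomorphic function of several variables are holomorphic:
they are given by a Cauchy integral over a small circle in the direction `v`, which may be
differentiated under the integral sign. -/
theorem DifferentiableOn.fderiv_apply_const {E : Type*} [NormedAddCommGroup E] [NormedSpace ℂ E]
    [FiniteDimensional ℂ E] {f : E → ℂ} {U : Set E} (hU : IsOpen U)
    (hf : DifferentiableOn ℂ f U) (v : E) :
    DifferentiableOn ℂ (fun x => fderiv ℂ f x v) U := by
  intro x₀ hx₀
  apply DifferentiableAt.differentiableWithinAt
  have : ProperSpace E := FiniteDimensional.proper ℂ E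
  have : ProperSpace (E →L[ℂ] ℂ) := FiniteDimensional.proper ℂ _
  borelize E
  borelize (E →L[ℂ] ℂ)
  -- `f` is bounded by `M` on a ball of radius `R`, which contains the balls of radius `R / 4`
  -- around the points of the circles in direction `v`.
  obtain ⟨R, hR, hRU⟩ := nhds_basis_closedBall.mem_iff.1 (hU.mem_nhds hx₀)
  obtain ⟨M, hM⟩ := (isCompact_closedBall x₀ R).exists_bound_of_continuousOn
    (hf.continuousOn.mono hRU)
  set r : ℝ := R / (4 * (‖v‖ + 1)) with hr
  have hv1 : 0 < ‖v‖ + 1 := by positivity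
  have hr0 : 0 < r := by positivity
  have hrv : r * ‖v‖ ≤ R / 4 := by
    rw [hr, div_mul_eq_mul_div, div_le_div_iff₀ (by positivity) (by positivity)]
    nlinarith [norm_nonneg v]
  have hmem : ∀ x ∈ ball x₀ (R / 4), ∀ ζ ∈ closedBall (0 : ℂ) r,
      ball (x + ζ • v) (R / 4) ⊆ closedBall x₀ R := by
    intro x hx ζ hζ y hy
    rw [mem_ball, dist_eq_norm] at hx hy
    rw [mem_closedBall, dist_zero_right] at hζ
    rw [mem_closedBall, dist_eq_norm]
    have h1 : ‖ζ • v‖ ≤ R / 4 := by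
      rw [norm_smul]
      exact (mul_le_mul_of_nonneg_right hζ (norm_nonneg v)).trans hrv
    have h2 : y - x₀ = (y - (x + ζ • v)) + (x - x₀) + ζ • v := by abel
    rw [h2]
    linarith [norm_add_le (y - (x + ζ • v) + (x - x₀)) (ζ • v),
      norm_add_le (y - (x + ζ • v)) (x - x₀)]
  have hmemU : ∀ x ∈ ball x₀ (R / 4), ∀ ζ ∈ closedBall (0 : ℂ) r, x + ζ • v ∈ U :=
    fun x hx ζ hζ => hRU (hmem x hx ζ hζ (mem_ball_self (by positivity)))
  have hline : ∀ x : E, Differentiable ℂ fun ζ : ℂ => x + ζ • v := fun x => by fun_prop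
  have hcauchy : ∀ x ∈ ball x₀ (R / 4), fderiv ℂ f x v =
      (2 * Real.pi * Complex.I : ℂ)⁻¹ • ∮ ζ in C(0, r), (1 / (ζ - 0) ^ 2) • f (x + ζ • v) := by
    intro x hx
    have hd : DifferentiableOn ℂ (fun ζ : ℂ => f (x + ζ • v)) (closedBall 0 r) :=
      hf.comp (hline x).differentiableOn (fun ζ hζ => hmemU x hx ζ hζ)
    rw [hd.deriv_eq_smul_circleIntegral hr0, smul_smul, inv_mul_cancel₀ (by
      simp [Real.pi_ne_zero]), one_smul]
    have hx0 : x + (0 : ℂ) • v ∈ U := hmemU x hx 0 (by simp [hr0.le])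
    have h1 : HasDerivAt (fun ζ : ℂ => x + ζ • v) v 0 := by
      simpa using ((hasDerivAt_id (0 : ℂ)).smul_const v).const_add x
    have h2 : HasFDerivAt f (fderiv ℂ f x) (x + (0 : ℂ) • v) := by
      have := (hf.differentiableAt (hU.mem_nhds hx0)).hasFDerivAt
      simpa using this
    exact (h2.comp_hasDerivAt 0 h1).deriv.symm
  have hev : (fun x => fderiv ℂ f x v) =ᶠ[𝓝 x₀] fun x =>
      (2 * Real.pi * Complex.I : ℂ)⁻¹ • ∮ ζ in C(0, r), (1 / (ζ - 0) ^ 2) • f (x + ζ • v) :=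
    Filter.mem_of_superset (ball_mem_nhds x₀ (by positivity : 0 < R / 4)) hcauchy
  refine DifferentiableAt.congr_of_eventuallyEq ?_ hev
  refine DifferentiableAt.const_smul (R := ℂ) ?_ _
  unfold circleIntegral
  have hcm : ∀ θ, circleMap 0 r θ ∈ closedBall (0 : ℂ) r := fun θ =>
    sphere_subset_closedBall (circleMap_mem_sphere 0 hr0.le θ)
  set k : ℝ → ℂ := fun θ => _root_.deriv (circleMap 0 r) θ * (1 / (circleMap 0 r θ - 0) ^ 2) with hk
  have hkc : Continuous k := by
    simp only [hk, deriv_circleMap]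
    have h0 : ∀ θ, (circleMap 0 r θ - 0) ^ 2 ≠ 0 := fun θ => by
      simp [hr0.ne']
    fun_prop (disch := exact h0 _)
  have hcont : ∀ x ∈ ball x₀ (R / 4), Continuous fun θ => k θ * f (x + circleMap 0 r θ • v) := by
    intro x hx
    refine hkc.mul ?_
    exact hf.continuousOn.comp_continuous (by fun_prop) (fun θ => hmemU x hx _ (hcm θ))
  have key := intervalIntegral.hasFDerivAt_integral_of_dominated_of_fderiv_le (𝕜 := ℂ)
    (μ := MeasureTheory.volume) (a := 0) (b := 2 * Real.pi) (x₀ := x₀)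
    (F := fun x θ => k θ * f (x + circleMap 0 r θ • v))
    (F' := fun x θ => k θ • fderiv ℂ f (x + circleMap 0 r θ • v))
    (bound := fun θ => ‖k θ‖ * (M / (R / 4 / 2)))
    (ball_mem_nhds x₀ (by positivity : 0 < R / 4)) ?_ ?_ ?_ ?_ ?_ ?_
  · refine key.differentiableAt.congr_of_eventuallyEq (Eventually.of_forall fun x => ?_)
    simp only [hk, smul_eq_mul, mul_assoc]
  · filter_upwards [ball_mem_nhds x₀ (by positivity : 0 < R / 4)] with x hx
    exact (hcont x hx).aestronglyMeasurable
  · exact (hcont x₀ (mem_ball_self (by positivity))).intervalIntegrable _ _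
  · have hm : Measurable fun θ : ℝ => fderiv ℂ f (x₀ + circleMap 0 r θ • v) :=
      (measurable_fderiv ℂ f).comp (by fun_prop : Continuous fun θ : ℝ =>
        x₀ + circleMap 0 r θ • v).measurable
    exact hkc.aestronglyMeasurable.smul hm.aestronglyMeasurable
  · refine Eventually.of_forall fun θ _ x hx => ?_
    rw [norm_smul]
    have hsub := hmem x hx _ (hcm θ)
    exact mul_le_mul_of_nonneg_left (norm_fderiv_le_of_forall_ball_norm_le (by positivity)
      (hf.mono (hsub.trans hRU)) (fun y hy => hM y (hsub hy))) (norm_nonneg _)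
  · exact (hkc.norm.mul continuous_const).intervalIntegrable _ _
  · refine Eventually.of_forall fun θ _ x hx => ?_
    have h2 := (hf.differentiableAt (hU.mem_nhds (hmemU x hx _ (hcm θ)))).hasFDerivAt
    have h1 : HasFDerivAt (fun x => x + circleMap 0 r θ • v) (ContinuousLinearMap.id ℂ E) x :=
      (hasFDerivAt_id x).add_const _
    simpa using (h2.comp x h1).const_mul (k θ)

theorem DifferentiableOn.contDiffOn_of_finiteDimensional {E : Type*} [NormedAddCommGroup E]
    [NormedSpace ℂ E] [FiniteDimensional ℂ E] {U : Set E} (hU : IsOpen U) (n : ℕ) :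
    ∀ {f : E → ℂ}, DifferentiableOn ℂ f U → ContDiffOn ℂ n f U := by
  induction n with
  | zero => intro f hf; exact contDiffOn_zero.2 hf.continuousOn
  | succ n ih =>
    intro f hf
    rw [Nat.cast_succ, contDiffOn_succ_iff_fderiv_of_isOpen hU]
    refine ⟨hf, by simp, ?_⟩
    rw [contDiffOn_clm_apply]
    exact fun v => ih (hf.fderiv_apply_const hU v)

/-- The identity theorem in any complex normed space, obtained by restriction to complex lines. -/
theorem DifferentiableOn.eqOn_zero_of_isPreconnected {E : Type*} [NormedAddCommGroup E]
    [NormedSpace ℂ E] {U : Set E} (hU : IsOpen U) (hU' : IsPreconnected U) {f : E → ℂ}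
    (hf : DifferentiableOn ℂ f U) {z : E} (hz : z ∈ U) (h0 : f =ᶠ[𝓝 z] 0) : EqOn f 0 U := by
  suffices h : U ⊆ {x | f =ᶠ[𝓝 x] 0} from fun x hx => (h hx).self_of_nhds
  refine hU'.subset_of_closure_inter_subset isOpen_setOfPred_eventually_nhds ⟨z, hz, h0⟩ ?_
  rintro x ⟨hx, hxU⟩
  obtain ⟨r, hr, hrU⟩ := nhds_basis_ball.mem_iff.1 (hU.mem_nhds hxU)
  obtain ⟨s, hs, hsx⟩ := Metric.mem_closure_iff.1 hx r hr
  rw [dist_comm] at hsx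
  refine Filter.mem_of_superset (ball_mem_nhds x hr) fun y hy => ?_
  set l : ℂ → E := fun t => s + t • (y - s) with hl
  have hlc : Continuous l := by fun_prop
  have hT : IsOpen (l ⁻¹' ball x r) := isOpen_ball.preimage hlc
  have hTc : IsPreconnected (l ⁻¹' ball x r) := by
    apply Convex.isPreconnected
    have : l ⁻¹' ball x r =
        (LinearMap.toSpanSingleton ℂ E (y - s)).restrictScalars ℝ ⁻¹' ball (x - s) r := by
      ext t
      simp only [hl, mem_preimage, mem_ball, dist_eq_norm, LinearMap.restrictScalars_apply,
        LinearMap.toSpanSingleton_apply]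
      rw [show s + t • (y - s) - x = t • (y - s) - (x - s) by abel]
    rw [this]
    exact (convex_ball (x - s) r).linear_preimage _
  have hd : DifferentiableOn ℂ (f ∘ l) (l ⁻¹' ball x r) :=
    (hf.mono hrU).comp (by fun_prop) (fun _ h => h)
  have h0' : f ∘ l =ᶠ[𝓝 0] 0 := by
    have : Tendsto l (𝓝 0) (𝓝 s) := by
      have := hlc.tendsto 0
      simpa [hl] using this
    exact this.eventually hs
  have := (hd.analyticOnNhd hT).eqOn_zero_of_preconnected_of_eventuallyEq_zero hTc
    (z₀ := 0) (by simpa [hl] using hsx) h0' (x := 1) (by simpa [hl] using hy)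
  simpa [hl] using this

/-! ### Functions killed by two vector fields -/

theorem hasDerivAt_comp_line {E F : Type*} [NormedAddCommGroup E] [NormedSpace ℂ E]
    [NormedAddCommGroup F] [NormedSpace ℂ F] {f : E → F} {z : E} (hf : DifferentiableAt ℂ f z)
    (v : E) : HasDerivAt (fun t : ℂ => f (z + t • v)) (fderiv ℂ f z v) 0 := by
  have h1 : HasDerivAt (fun t : ℂ => z + t • v) v 0 := by
    simpa using ((hasDerivAt_id (0 : ℂ)).smul_const v).const_add z
  have h2 : HasFDerivAt f (fderiv ℂ f z) (z + (0 : ℂ) • v) := by simpa using hf.hasFDerivAt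
  exact h2.comp_hasDerivAt 0 h1

/-- If two vector fields kill `f`, then so does their Lie bracket; here `A - B` is minus the bracket
of `X` and `Y`, with the two directional derivatives given explicitly. -/
theorem fderiv_apply_sub_eq_zero {E : Type*} [NormedAddCommGroup E] [NormedSpace ℂ E]
    {f : E → ℂ} {U : Set E} (hU : IsOpen U) (hf : ContDiffOn ℂ 2 f U) {X Y : E → E}
    (hX : ∀ z ∈ U, fderiv ℂ f z (X z) = 0) (hY : ∀ z ∈ U, fderiv ℂ f z (Y z) = 0)
    {z : E} (hz : z ∈ U) {A B : E} (hA : HasDerivAt (fun t : ℂ => X (z + t • Y z)) A 0)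
    (hB : HasDerivAt (fun t : ℂ => Y (z + t • X z)) B 0) : fderiv ℂ f z (A - B) = 0 := by
  have hd : DifferentiableAt ℂ (fderiv ℂ f) z := by
    have h1 := (contDiffOn_succ_iff_fderiv_of_isOpen (n := 1) hU).1 (by rwa [one_add_one_eq_two])
    exact (h1.2.2.differentiableOn (by simp)).differentiableAt (hU.mem_nhds hz)
  have hsymm : IsSymmSndFDerivAt ℂ f z :=
    (hf.contDiffAt (hU.mem_nhds hz)).isSymmSndFDerivAt (by simp)
  have key : ∀ X Y : E → E, (∀ z ∈ U, fderiv ℂ f z (X z) = 0) → ∀ A : E,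
      HasDerivAt (fun t : ℂ => X (z + t • Y z)) A 0 →
      fderiv ℂ (fderiv ℂ f) z (Y z) (X z) + fderiv ℂ f z A = 0 := by
    intro X Y hX A hA
    have h1 := (hasDerivAt_comp_line hd (Y z)).clm_apply hA
    simp only [zero_smul, add_zero] at h1
    have hc : Tendsto (fun t : ℂ => z + t • Y z) (𝓝 0) (𝓝 z) := by
      have : Continuous fun t : ℂ => z + t • Y z := by fun_prop
      simpa using this.tendsto 0
    have h2 : (fun t : ℂ => fderiv ℂ f (z + t • Y z) (X (z + t • Y z))) =ᶠ[𝓝 0] fun _ => 0 :=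
      (hc.eventually (hU.mem_nhds hz)).mono fun t ht => hX _ ht
    exact h1.unique ((hasDerivAt_const (0 : ℂ) (0 : ℂ)).congr_of_eventuallyEq h2)
  have e1 := key X Y hX A hA
  have e2 := key Y X hY B hB
  rw [hsymm (X z) (Y z)] at e2
  rw [map_sub]
  linear_combination e1 - e2

/-- The direction in which a window moves when `(y (k+1) - 1) * (y k + 1)` is kept fixed for all
`k`, written in the coordinates of `chart` and scaled to be polynomial. -/
def fieldV (w : Fin 5 → ℂ) : Fin 5 → ℂ :=
  ![-((w 2 + 1) * (w 0 - w 1 ^ 2 - 2 * w 1 + 1)), -((w 2 + 1) * (w 1 + 1)), w 2 ^ 2 - 1,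
    -((w 2 - 1) * (w 3 - 1)), -((w 2 - 1) * (w 4 + w 3 ^ 2 - 2 * w 3 - 1))]

/-- The direction in which a window moves when `(x (k+1) + 1) * (x k - 1)` is kept fixed for all
`k`, written in the coordinates of `chart` and scaled to be polynomial. -/
def fieldW (w : Fin 5 → ℂ) : Fin 5 → ℂ :=
  ![-((w 2 - 1) * (w 0 + w 1 ^ 2 - 2 * w 1 - 1)), -((w 2 - 1) * (w 1 - 1)), w 2 ^ 2 - 1,
    -((w 2 + 1) * (w 3 + 1)), -((w 2 + 1) * (w 4 - w 3 ^ 2 - 2 * w 3 + 1))]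

theorem hasDerivAt_add_smul_apply {ι : Type*} (z y : ι → ℂ) (i : ι) :
    HasDerivAt (fun t : ℂ => (z + t • y) i) (y i) 0 := by
  simpa using ((hasDerivAt_id (0 : ℂ)).mul_const (y i)).const_add (z i)

theorem hasDerivAt_fieldV (z y : Fin 5 → ℂ) :
    HasDerivAt (fun t : ℂ => fieldV (z + t • y))
      ![-(y 2 * (z 0 - z 1 ^ 2 - 2 * z 1 + 1) + (z 2 + 1) * (y 0 - 2 * z 1 * y 1 - 2 * y 1)),
        -(y 2 * (z 1 + 1) + (z 2 + 1) * y 1), 2 * z 2 * y 2,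
        -(y 2 * (z 3 - 1) + (z 2 - 1) * y 3),
        -(y 2 * (z 4 + z 3 ^ 2 - 2 * z 3 - 1) + (z 2 - 1) * (y 4 + 2 * z 3 * y 3 - 2 * y 3))]
      0 := by
  have h := hasDerivAt_add_smul_apply z y
  refine hasDerivAt_pi.2 fun i => ?_
  fin_cases i
  · refine (((h 2).add_const 1).mul ((((h 0).sub ((h 1).pow 2)).sub
      ((h 1).const_mul 2)).add_const 1)).neg.congr_deriv ?_
    simp
  · refine (((h 2).add_const 1).mul ((h 1).add_const 1)).neg.congr_deriv ?_
    simp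
  · refine (((h 2).pow 2).sub_const 1).congr_deriv ?_
    simp
  · refine (((h 2).sub_const 1).mul ((h 3).sub_const 1)).neg.congr_deriv ?_
    simp
  · refine (((h 2).sub_const 1).mul ((((h 4).add ((h 3).pow 2)).sub
      ((h 3).const_mul 2)).sub_const 1)).neg.congr_deriv ?_
    simp

theorem hasDerivAt_fieldW (z y : Fin 5 → ℂ) :
    HasDerivAt (fun t : ℂ => fieldW (z + t • y))
      ![-(y 2 * (z 0 + z 1 ^ 2 - 2 * z 1 - 1) + (z 2 - 1) * (y 0 + 2 * z 1 * y 1 - 2 * y 1)),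
        -(y 2 * (z 1 - 1) + (z 2 - 1) * y 1), 2 * z 2 * y 2,
        -(y 2 * (z 3 + 1) + (z 2 + 1) * y 3),
        -(y 2 * (z 4 - z 3 ^ 2 - 2 * z 3 + 1) + (z 2 + 1) * (y 4 - 2 * z 3 * y 3 - 2 * y 3))]
      0 := by
  have h := hasDerivAt_add_smul_apply z y
  refine hasDerivAt_pi.2 fun i => ?_
  fin_cases i
  · refine (((h 2).sub_const 1).mul ((((h 0).add ((h 1).pow 2)).sub
      ((h 1).const_mul 2)).sub_const 1)).neg.congr_deriv ?_
    simp
  · refine (((h 2).sub_const 1).mul ((h 1).sub_const 1)).neg.congr_deriv ?_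
    simp
  · refine (((h 2).pow 2).sub_const 1).congr_deriv ?_
    simp
  · refine (((h 2).add_const 1).mul ((h 3).add_const 1)).neg.congr_deriv ?_
    simp
  · refine (((h 2).add_const 1).mul ((((h 4).sub ((h 3).pow 2)).sub
      ((h 3).const_mul 2)).add_const 1)).neg.congr_deriv ?_
    simp

/-- A function killed by `fieldV` and `fieldW` has zero derivative. The bracket of the two fields is
a multiple of the constant field `C = ∂₃ - ∂₁`; the fields `[V, C]`, `[W, C]`, `[[V, C], C]` and
`[[W, C], C]` complete a spanning set wherever `w 2` is not `0`, `1` or `-1`. -/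
theorem fderiv_eq_zero_of_fieldV_of_fieldW {G : (Fin 5 → ℂ) → ℂ} {U : Set (Fin 5 → ℂ)}
    (hU : IsOpen U) (hG : DifferentiableOn ℂ G U) (hV : ∀ w ∈ U, fderiv ℂ G w (fieldV w) = 0)
    (hW : ∀ w ∈ U, fderiv ℂ G w (fieldW w) = 0) (hs : ∀ w ∈ U, w 2 ≠ 0)
    (hs' : ∀ w ∈ U, w 2 ^ 2 - 1 ≠ 0) {w : Fin 5 → ℂ} (hw : w ∈ U) : fderiv ℂ G w = 0 := by
  have hG2 : ContDiffOn ℂ 2 G U := hG.contDiffOn_of_finiteDimensional hU 2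
  have expand : ∀ (L : (Fin 5 → ℂ) →L[ℂ] ℂ) (ξ : Fin 5 → ℂ),
      L ξ = ξ 0 * L (Pi.single 0 1) + ξ 1 * L (Pi.single 1 1) + ξ 2 * L (Pi.single 2 1)
        + ξ 3 * L (Pi.single 3 1) + ξ 4 * L (Pi.single 4 1) := by
    intro L ξ
    conv_lhs => rw [pi_eq_sum_univ' ξ]
    simp [Fin.sum_univ_five]
  have hC : ∀ w ∈ U, fderiv ℂ G w ![0, -1, 0, 1, 0] = 0 := by
    intro w hw
    have h := fderiv_apply_sub_eq_zero hU hG2 hV hW hw (hasDerivAt_fieldV w _)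
      (hasDerivAt_fieldW w _)
    refine (mul_eq_zero.1 (?_ : (w 2 ^ 2 - 1) * _ = 0)).resolve_left (hs' w hw)
    rw [expand] at h ⊢
    simp [fieldV, fieldW, -mul_eq_zero] at h ⊢
    linear_combination h / 4
  have hV1 : ∀ w ∈ U, fderiv ℂ G w ![-(w 2 + 1) * (2 * w 1 + 2), w 2 + 1, 0, -(w 2 - 1),
      -(w 2 - 1) * (2 * w 3 - 2)] = 0 := by
    intro w hw
    have h := fderiv_apply_sub_eq_zero hU hG2 hV hC hw (hasDerivAt_fieldV w _)
      (hasDerivAt_const _ _)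
    rw [expand] at h ⊢
    simp at h ⊢
    linear_combination h
  have hW1 : ∀ w ∈ U, fderiv ℂ G w ![(w 2 - 1) * (2 * w 1 - 2), w 2 - 1, 0, -(w 2 + 1),
      (w 2 + 1) * (2 * w 3 + 2)] = 0 := by
    intro w hw
    have h := fderiv_apply_sub_eq_zero hU hG2 hW hC hw (hasDerivAt_fieldW w _)
      (hasDerivAt_const _ _)
    rw [expand] at h ⊢
    simp at h ⊢
    linear_combination h
  have hV2 : fderiv ℂ G w ![2 * (w 2 + 1), 0, 0, 0, -2 * (w 2 - 1)] = 0 := by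
    have h := fderiv_apply_sub_eq_zero hU hG2 hV1 hC hw
      (A := ![2 * (w 2 + 1), 0, 0, 0, -2 * (w 2 - 1)]) ?_ (hasDerivAt_const _ _)
    · simpa using h
    · have h := hasDerivAt_add_smul_apply w ![0, -1, 0, 1, 0]
      refine hasDerivAt_pi.2 fun i => ?_
      fin_cases i
      · refine (((h 2).add_const 1).neg.mul (((h 1).const_mul 2).add_const 2)).congr_deriv ?_
        simp; ring
      · refine ((h 2).add_const 1).congr_deriv ?_
        simp
      · exact hasDerivAt_const _ _
      · refine ((h 2).sub_const 1).neg.congr_deriv ?_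
        simp
      · refine (((h 2).sub_const 1).neg.mul (((h 3).const_mul 2).sub_const 2)).congr_deriv ?_
        simp; ring
  have hW2 : fderiv ℂ G w ![-2 * (w 2 - 1), 0, 0, 0, 2 * (w 2 + 1)] = 0 := by
    have h := fderiv_apply_sub_eq_zero hU hG2 hW1 hC hw
      (A := ![-2 * (w 2 - 1), 0, 0, 0, 2 * (w 2 + 1)]) ?_ (hasDerivAt_const _ _)
    · simpa using h
    · have h := hasDerivAt_add_smul_apply w ![0, -1, 0, 1, 0]
      refine hasDerivAt_pi.2 fun i => ?_
      fin_cases i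
      · refine (((h 2).sub_const 1).mul (((h 1).const_mul 2).sub_const 2)).congr_deriv ?_
        simp; ring
      · refine ((h 2).sub_const 1).congr_deriv ?_
        simp
      · exact hasDerivAt_const _ _
      · refine ((h 2).add_const 1).neg.congr_deriv ?_
        simp
      · refine (((h 2).add_const 1).mul (((h 3).const_mul 2).add_const 2)).congr_deriv ?_
        simp; ring
  have e0 := hV w hw
  have e1 := hC w hw
  have e2 := hV1 w hw
  have hs := hs w hw
  have hs' := hs' w hw
  ext ξ
  rw [expand] at e0 e1 e2 hV2 hW2 ⊢
  generalize fderiv ℂ G w (Pi.single 0 1) = l0 at *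
  generalize fderiv ℂ G w (Pi.single 1 1) = l1 at *
  generalize fderiv ℂ G w (Pi.single 2 1) = l2 at *
  generalize fderiv ℂ G w (Pi.single 3 1) = l3 at *
  generalize fderiv ℂ G w (Pi.single 4 1) = l4 at *
  simp [fieldV] at e0 e1 e2 hV2 hW2 ⊢
  have h0 : l0 = 0 := (mul_eq_zero.1 (by linear_combination (w 2 + 1) / 8 * hV2 +
    (w 2 - 1) / 8 * hW2 : w 2 * l0 = 0)).resolve_left hs
  have h4 : l4 = 0 := (mul_eq_zero.1 (by linear_combination (w 2 - 1) / 8 * hV2 +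
    (w 2 + 1) / 8 * hW2 : w 2 * l4 = 0)).resolve_left hs
  subst h0 h4
  have h1 : l1 = 0 := by linear_combination (e2 + (w 2 - 1) * e1) / 2
  have h3 : l3 = 0 := by linear_combination e1 + h1
  subst h1 h3
  have h2 : l2 = 0 := (mul_eq_zero.1 (by linear_combination e0 :
    (w 2 ^ 2 - 1) * l2 = 0)).resolve_left hs'
  simp [h2]

/-! ### The invariant fields in window coordinates -/

/-- Coordinates on windows of length five. The outer entries are replaced by
`(z 1 ^ 2 - 1) * z 0 + 2 * z 1` and `(z 3 ^ 2 - 1) * z 4 + 2 * z 3`; the map `chart` recovers the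
window from these coordinates. The choice makes the bracket of the two invariant fields a multiple
of a constant field. -/
noncomputable def chart (w : Fin 5 → ℂ) : Fin 5 → ℂ :=
  ![(w 0 - 2 * w 1) / (w 1 ^ 2 - 1), w 1, w 2, w 3, (w 4 - 2 * w 3) / (w 3 ^ 2 - 1)]

/-- The coordinates of a window, a right inverse of `chart` on regular windows. -/
def chartInv (z : Fin 5 → ℂ) : Fin 5 → ℂ :=
  ![(z 1 ^ 2 - 1) * z 0 + 2 * z 1, z 1, z 2, z 3, (z 3 ^ 2 - 1) * z 4 + 2 * z 3]

theorem chart_chartInv {z : Fin 5 → ℂ} (h1 : z 1 ^ 2 - 1 ≠ 0) (h3 : z 3 ^ 2 - 1 ≠ 0) :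
    chart (chartInv z) = z := by
  ext i
  fin_cases i <;> simp [chart, chartInv, h1, h3]

theorem differentiableAt_chart {w : Fin 5 → ℂ} (h1 : w 1 ^ 2 - 1 ≠ 0) (h3 : w 3 ^ 2 - 1 ≠ 0) :
    DifferentiableAt ℂ chart w := by
  refine differentiableAt_pi.2 fun i => ?_
  have hp : ∀ j : Fin 5, DifferentiableAt ℂ (fun w : Fin 5 → ℂ => w j) w := fun j => by fun_prop
  fin_cases i
  · change DifferentiableAt ℂ (fun w : Fin 5 → ℂ => (w 0 - 2 * w 1) / (w 1 ^ 2 - 1)) w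
    simp only [div_eq_mul_inv]
    fun_prop (disch := assumption)
  · exact hp 1
  · exact hp 2
  · exact hp 3
  · change DifferentiableAt ℂ (fun w : Fin 5 → ℂ => (w 4 - 2 * w 3) / (w 3 ^ 2 - 1)) w
    simp only [div_eq_mul_inv]
    fun_prop (disch := assumption)

theorem hasDerivAt_chart {w : Fin 5 → ℂ} (h1 : w 1 ^ 2 - 1 ≠ 0) (h3 : w 3 ^ 2 - 1 ≠ 0)
    (y : Fin 5 → ℂ) : HasDerivAt (fun t : ℂ => chart (w + t • y))
      ![(y 0 - 2 * y 1 - 2 * w 1 * chart w 0 * y 1) / (w 1 ^ 2 - 1), y 1, y 2, y 3,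
        (y 4 - 2 * y 3 - 2 * w 3 * chart w 4 * y 3) / (w 3 ^ 2 - 1)] 0 := by
  have h := hasDerivAt_add_smul_apply w y
  refine hasDerivAt_pi.2 fun i => ?_
  fin_cases i
  · refine (((h 0).sub ((h 1).const_mul 2)).div (((h 1).pow 2).sub_const 1)
      (by simpa using h1)).congr_deriv ?_
    simp [chart]
    field_simp
  · exact h 1
  · exact h 2
  · exact h 3
  · refine (((h 4).sub ((h 3).const_mul 2)).div (((h 3).pow 2).sub_const 1)
      (by simpa using h3)).congr_deriv ?_
    simp [chart]
    field_simp

/-- `fderiv_eq_zero_of_fieldV_of_fieldW` in terms of the window itself. The relations on `v` express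
that `v` is tangent to the level sets of `(z (k+1) - 1) * (z k + 1)`, respectively
`(z (k+1) + 1) * (z k - 1)`. -/
theorem exists_eventuallyEq_const {f : (Fin 5 → ℂ) → ℂ} {O : Set (Fin 5 → ℂ)} (hO : IsOpen O)
    (hf : DifferentiableOn ℂ f O)
    (hreg : ∀ z ∈ O, z 2 ≠ 0 ∧ ∀ i, z i ^ 2 - 1 ≠ 0)
    (hV : ∀ z ∈ O, ∀ v : Fin 5 → ℂ, (∀ k : Fin 4, v k.succ * (z k.castSucc + 1) +
      v k.castSucc * (z k.succ - 1) = 0) → fderiv ℂ f z v = 0)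
    (hW : ∀ z ∈ O, ∀ v : Fin 5 → ℂ, (∀ k : Fin 4, v k.succ * (z k.castSucc - 1) +
      v k.castSucc * (z k.succ + 1) = 0) → fderiv ℂ f z v = 0) {z : Fin 5 → ℂ} (hz : z ∈ O) :
    ∃ c, f =ᶠ[𝓝 z] fun _ => c := by
  set A : Set (Fin 5 → ℂ) := {w | w 1 ^ 2 - 1 ≠ 0 ∧ w 3 ^ 2 - 1 ≠ 0} with hA
  have hAo : IsOpen A := by
    rw [hA, ofPred_and]
    exact (isOpen_ne_fun (by fun_prop) (by fun_prop)).inter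
      (isOpen_ne_fun (by fun_prop) (by fun_prop))
  have hchart : DifferentiableOn ℂ chart A := fun w hw =>
    (differentiableAt_chart hw.1 hw.2).differentiableWithinAt
  set U : Set (Fin 5 → ℂ) := A ∩ chart ⁻¹' O with hUdef
  have hU : IsOpen U := hchart.continuousOn.isOpen_inter_preimage hAo hO
  have hfd : ∀ w ∈ U, DifferentiableAt ℂ f (chart w) := fun w hw =>
    hf.differentiableAt (hO.mem_nhds hw.2)
  have hG : DifferentiableOn ℂ (f ∘ chart) U := fun w hw =>
    ((hfd w hw).comp w (differentiableAt_chart hw.1.1 hw.1.2)).differentiableWithinAt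
  have hfderiv : ∀ w ∈ U, ∀ y A : Fin 5 → ℂ, HasDerivAt (fun t : ℂ => chart (w + t • y)) A 0 →
      fderiv ℂ (f ∘ chart) w y = fderiv ℂ f (chart w) A := by
    intro w hw y A hA
    have h1 := hasDerivAt_comp_line ((hfd w hw).comp w (differentiableAt_chart hw.1.1 hw.1.2)) y
    have h2 : HasFDerivAt f (fderiv ℂ f (chart w)) (chart (w + (0 : ℂ) • y)) := by
      simpa using (hfd w hw).hasFDerivAt
    exact h1.unique (h2.comp_hasDerivAt 0 hA)
  have hV' : ∀ w ∈ U, fderiv ℂ (f ∘ chart) w (fieldV w) = 0 := by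
    intro w hw
    rw [hfderiv w hw _ _ (hasDerivAt_chart hw.1.1 hw.1.2 _)]
    apply hV _ hw.2
    have h1 := hw.1.1
    have h3 := hw.1.2
    intro k
    fin_cases k
    · simp [chart, fieldV]
      field_simp
      ring
    · simp [chart, fieldV]
      ring
    · simp [chart, fieldV]
      ring
    · simp [chart, fieldV]
      field_simp
      ring
  have hW' : ∀ w ∈ U, fderiv ℂ (f ∘ chart) w (fieldW w) = 0 := by
    intro w hw
    rw [hfderiv w hw _ _ (hasDerivAt_chart hw.1.1 hw.1.2 _)]
    apply hW _ hw.2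
    have h1 := hw.1.1
    have h3 := hw.1.2
    intro k
    fin_cases k
    · simp [chart, fieldW]
      field_simp
      ring
    · simp [chart, fieldW]
      ring
    · simp [chart, fieldW]
      ring
    · simp [chart, fieldW]
      field_simp
      ring
  have hzr := (hreg z hz).2
  have hzc : chart (chartInv z) = z := chart_chartInv (hzr 1) (hzr 3)
  have hzU : chartInv z ∈ U := ⟨⟨hzr 1, hzr 3⟩, by rwa [mem_preimage, hzc]⟩
  obtain ⟨r, hr, hrU⟩ := nhds_basis_ball.mem_iff.1 (hU.mem_nhds hzU)
  refine ⟨f z, ?_⟩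
  have hball : ∀ w ∈ ball (chartInv z) r, f (chart w) = f z := by
    intro w hw
    have := isOpen_ball.is_const_of_fderiv_eq_zero (𝕜 := ℂ)
      (convex_ball (chartInv z) r).isPreconnected
      (hG.mono hrU) (fun w hw => fderiv_eq_zero_of_fieldV_of_fieldW hU hG hV' hW'
        (fun w hw => (hreg _ hw.2).1) (fun w hw => (hreg _ hw.2).2 2) (hrU hw)) hw
      (mem_ball_self hr)
    simpa [hzc] using this
  have hcont : Continuous chartInv := by
    refine continuous_pi fun i => ?_
    fin_cases i <;> simp [chartInv] <;> fun_prop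
  have hev : ∀ᶠ z' in 𝓝 z, z' ∈ O := hO.mem_nhds hz
  filter_upwards [hev, hcont.continuousAt.preimage_mem_nhds (ball_mem_nhds _ hr)] with z' h1 h2
  have h4 := (hreg z' h1).2
  rw [← hball _ h2, chart_chartInv (h4 1) (h4 3)]

/-! ### Windows of neighbouring columns -/

/-- Two finite windows `p`, `q` satisfy the discrete equation as neighbouring columns when `ε = 1`.
The sign `ε` makes the relation symmetric: exchanging `p` and `q` replaces `ε` by `-ε` and `β` by
its inverse. -/
def Linked {n : ℕ} (ε β : ℂ) (p q : Fin (n + 1) → ℂ) : Prop :=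
  ∀ k : Fin n, (p k.succ + ε) * (p k.castSucc - ε) = β * ((q k.succ - ε) * (q k.castSucc + ε))

theorem Linked.symm {n : ℕ} {ε β : ℂ} (hβ : β ≠ 0) {p q : Fin (n + 1) → ℂ}
    (h : Linked ε β p q) : Linked (-ε) β⁻¹ q p := by
  intro k
  have := h k
  field_simp
  linear_combination -this

/-- The left window can be solved for, continuously, from the right one, by recursion upwards from
its lowest entry, which is kept fixed. -/
theorem Linked.eventually_exists_left {n : ℕ} {ε β : ℂ} {p₀ q₀ : Fin (n + 1) → ℂ}
    (h : Linked ε β p₀ q₀) (hp : ∀ i, p₀ i ≠ ε) {N : (Fin (n + 1) → ℂ) × (Fin (n + 1) → ℂ) → Prop}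
    (hN : ∀ᶠ pq in 𝓝 (p₀, q₀), N pq) : ∀ᶠ q in 𝓝 q₀, ∃ p, Linked ε β p q ∧ N (p, q) := by
  set P : (Fin (n + 1) → ℂ) → Fin (n + 1) → ℂ := fun q =>
    Fin.induction (motive := fun _ => ℂ) (p₀ 0)
      (fun k y => -ε + β * ((q k.succ - ε) * (q k.castSucc + ε)) / (y - ε)) with hP
  have hPs : ∀ q k, P q (Fin.succ k) =
      -ε + β * ((q k.succ - ε) * (q k.castSucc + ε)) / (P q k.castSucc - ε) :=
    fun q k => Fin.induction_succ _ _ _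
  have hP0 : ∀ i, P q₀ i = p₀ i := by
    intro i
    induction i using Fin.induction with
    | zero => rfl
    | succ k ih =>
      have hne := sub_ne_zero.2 (hp k.castSucc)
      rw [hPs, ih, ← h k, mul_div_assoc, div_self hne]
      ring
  have hPc : ∀ i, ContinuousAt (fun q => P q i) q₀ := by
    intro i
    induction i using Fin.induction with
    | zero => exact continuousAt_const
    | succ k ih =>
      simp only [hPs]
      have hne : P q₀ k.castSucc - ε ≠ 0 := by rw [hP0]; exact sub_ne_zero.2 (hp _)
      exact continuousAt_const.add (ContinuousAt.div (by fun_prop) (ih.sub continuousAt_const) hne)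
  have hpair : Tendsto (fun q => (P q, q)) (𝓝 q₀) (𝓝 (p₀, q₀)) := by
    have := (continuousAt_pi.2 hPc).prodMk (continuousAt_id (x := q₀))
    rw [ContinuousAt, funext hP0] at this
    exact this
  have hne : ∀ᶠ q in 𝓝 q₀, ∀ i, P q i ≠ ε :=
    eventually_all.2 fun i => (hPc i).eventually_ne (by rw [hP0]; exact hp i)
  filter_upwards [hpair.eventually hN, hne] with q h1 h2
  refine ⟨P q, fun k => ?_, h1⟩
  have := sub_ne_zero.2 (h2 k.castSucc)
  rw [hPs]
  field_simp
  ring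

/-- With the left window fixed, the right one moves along a curve with any prescribed velocity `v`
that satisfies the linearised equation. -/
theorem Linked.exists_curve_right {n : ℕ} {ε β : ℂ} {p q v : Fin (n + 1) → ℂ}
    (h : Linked ε β p q) (hq : ∀ i, q i ≠ -ε)
    (hv : ∀ k : Fin n, v k.succ * (q k.castSucc + ε) + v k.castSucc * (q k.succ - ε) = 0) :
    ∃ Q : ℂ → Fin (n + 1) → ℂ, Q 0 = q ∧ HasDerivAt Q v 0 ∧ ∀ᶠ t in 𝓝 0, Linked ε β p (Q t) := by
  set Q : ℂ → Fin (n + 1) → ℂ := fun t =>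
    Fin.induction (motive := fun _ => ℂ) (q 0 + t * v 0)
      (fun k y => ε + (q k.succ - ε) * (q k.castSucc + ε) / (y + ε)) with hQ
  have hQs : ∀ t k, Q t (Fin.succ k) =
      ε + (q k.succ - ε) * (q k.castSucc + ε) / (Q t k.castSucc + ε) :=
    fun t k => Fin.induction_succ _ _ _
  have hne : ∀ i, q i + ε ≠ 0 := fun i hi => hq i (eq_neg_of_add_eq_zero_left hi)
  have hQ0 : ∀ i, Q 0 i = q i := by
    intro i
    induction i using Fin.induction with
    | zero => simp [hQ]
    | succ k ih =>
      rw [hQs, ih, mul_div_assoc, div_self (hne _)]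
      ring
  have hQd : ∀ i, HasDerivAt (fun t => Q t i) (v i) 0 := by
    intro i
    induction i using Fin.induction with
    | zero => simpa [hQ] using ((hasDerivAt_id (0 : ℂ)).mul_const (v 0)).const_add (q 0)
    | succ k ih =>
      simp only [hQs]
      have h1 : Q 0 k.castSucc + ε ≠ 0 := by rw [hQ0]; exact hne _
      refine (((hasDerivAt_const (0 : ℂ) ((q k.succ - ε) * (q k.castSucc + ε))).div
        (ih.add_const ε) h1).const_add ε).congr_deriv ?_
      have h2 := hne k.castSucc
      rw [hQ0]
      field_simp
      linear_combination -hv k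
  refine ⟨Q, funext hQ0, hasDerivAt_pi.2 hQd, ?_⟩
  have hne' : ∀ᶠ t in 𝓝 (0 : ℂ), ∀ i, Q t i ≠ -ε :=
    eventually_all.2 fun i => (hQd i).continuousAt.eventually_ne (by rw [hQ0]; exact hq i)
  filter_upwards [hne'] with t ht k
  have : Q t k.castSucc + ε ≠ 0 := fun h => ht _ (eq_neg_of_add_eq_zero_left h)
  rw [h k, hQs]
  field_simp
  ring

/-- If a function of the left window equals a function `g` of the right window whenever the two are
linked, then `g` is killed by the motions of the right window that keep the left one fixed. -/
theorem Linked.eventually_fderiv_right_eq_zero {n : ℕ} {ε β : ℂ} {p₀ q₀ : Fin (n + 1) → ℂ}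
    (h : Linked ε β p₀ q₀) (hp : ∀ i, p₀ i ≠ ε) (hq : ∀ i, q₀ i ≠ -ε)
    {f g : (Fin (n + 1) → ℂ) → ℂ} (hg : ∀ᶠ q in 𝓝 q₀, DifferentiableAt ℂ g q)
    (hfg : ∀ᶠ pq in 𝓝 (p₀, q₀), Linked ε β pq.1 pq.2 → f pq.1 = g pq.2) :
    ∀ᶠ q in 𝓝 q₀, ∀ v : Fin (n + 1) → ℂ,
      (∀ k : Fin n, v k.succ * (q k.castSucc + ε) + v k.castSucc * (q k.succ - ε) = 0) →
      fderiv ℂ g q v = 0 := by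
  have hq' : ∀ᶠ q in 𝓝 q₀, ∀ i, q i ≠ -ε :=
    eventually_all.2 fun i => (continuous_apply i).continuousAt.eventually_ne (hq i)
  filter_upwards [h.eventually_exists_left hp hfg.eventually_nhds, hg, hq']
    with q ⟨p, hpq, hN⟩ hgq hqi v hv
  obtain ⟨Q, hQ0, hQd, hQ⟩ := hpq.exists_curve_right hqi hv
  have hpair : Tendsto (fun t => (p, Q t)) (𝓝 0) (𝓝 (p, q)) := by
    have := (continuousAt_const (x := (0 : ℂ)) (y := p)).prodMk hQd.continuousAt
    rwa [ContinuousAt, hQ0] at this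
  have hconst : (fun t => g (Q t)) =ᶠ[𝓝 0] fun _ => f p := by
    filter_upwards [hpair.eventually hN, hQ] with t h1 h2
    exact (h1 h2).symm
  have h1 : HasFDerivAt g (fderiv ℂ g q) (Q 0) := by rw [hQ0]; exact hgq.hasFDerivAt
  exact (h1.comp_hasDerivAt 0 hQd).unique
    ((hasDerivAt_const (0 : ℂ) (f p)).congr_of_eventuallyEq hconst)

theorem Linked.eventually_fderiv_left_eq_zero {n : ℕ} {ε β : ℂ} (hβ : β ≠ 0)
    {p₀ q₀ : Fin (n + 1) → ℂ}
    (h : Linked ε β p₀ q₀) (hp : ∀ i, p₀ i ≠ ε) (hq : ∀ i, q₀ i ≠ -ε)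
    {f g : (Fin (n + 1) → ℂ) → ℂ} (hf : ∀ᶠ p in 𝓝 p₀, DifferentiableAt ℂ f p)
    (hfg : ∀ᶠ pq in 𝓝 (p₀, q₀), Linked ε β pq.1 pq.2 → f pq.1 = g pq.2) :
    ∀ᶠ p in 𝓝 p₀, ∀ v : Fin (n + 1) → ℂ,
      (∀ k : Fin n, v k.succ * (p k.castSucc - ε) + v k.castSucc * (p k.succ + ε) = 0) →
      fderiv ℂ f p v = 0 := by
  have hswap : ∀ᶠ qp in 𝓝 (q₀, p₀), Linked (-ε) β⁻¹ qp.1 qp.2 → g qp.1 = f qp.2 := by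
    have := (continuous_swap.tendsto (q₀, p₀)).eventually hfg
    filter_upwards [this] with qp h1 h2
    have h3 := h2.symm (inv_ne_zero hβ)
    rw [neg_neg, inv_inv] at h3
    exact (h1 h3).symm
  simpa [sub_eq_add_neg] using (h.symm hβ).eventually_fderiv_right_eq_zero hq
    (by simpa using hp) hf hswap

/-! ### Relative invariants vanish -/

theorem fderiv_div_apply {E : Type*} [NormedAddCommGroup E] [NormedSpace ℂ E] {f g : E → ℂ}
    {z : E} (hf : DifferentiableAt ℂ f z) (hg : DifferentiableAt ℂ g z) (h0 : g z ≠ 0) (v : E) :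
    fderiv ℂ (fun x => f x / g x) z v =
      (fderiv ℂ f z v * g z - f z * fderiv ℂ g z v) / g z ^ 2 := by
  have hd : DifferentiableAt ℂ (fun x => f x / g x) z := by
    simp only [div_eq_mul_inv]
    fun_prop (disch := assumption)
  have := (hasDerivAt_comp_line hf v).div (hasDerivAt_comp_line hg v) (by simpa using h0)
  simpa using (hasDerivAt_comp_line hd v).unique this

/-- The polynomial field spanning the motions of a left window with the right one fixed. -/
noncomputable def leftField {n : ℕ} (ε : ℂ) (p : Fin (n + 1) → ℂ) (i : Fin (n + 1)) : ℂ :=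
  ∏ j : Fin n, if j.castSucc < i then -(p j.succ + ε) else p j.castSucc - ε

theorem leftField_rel {n : ℕ} (ε : ℂ) (p : Fin (n + 1) → ℂ) (k : Fin n) :
    leftField ε p k.succ * (p k.castSucc - ε) + leftField ε p k.castSucc * (p k.succ + ε) = 0 := by
  unfold leftField
  -- The two products differ only in the factor with index `k`.
  rw [← Finset.mul_prod_erase _ _ (Finset.mem_univ k), ← Finset.mul_prod_erase
    (f := fun j : Fin n => if j.castSucc < k.castSucc then -(p j.succ + ε) else p j.castSucc - ε)
    _ (Finset.mem_univ k)]
  have : ∀ j ∈ Finset.univ.erase k, (if j.castSucc < k.succ then -(p j.succ + ε) else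
      p j.castSucc - ε) = if j.castSucc < k.castSucc then -(p j.succ + ε) else
      p j.castSucc - ε := by
    intro j hj
    have hjk : j ≠ k := Finset.ne_of_mem_erase hj
    have : j.castSucc < k.succ ↔ j.castSucc < k.castSucc := by
      rw [Fin.castSucc_lt_succ_iff, Fin.castSucc_lt_castSucc_iff, le_iff_lt_or_eq]
      simp [hjk]
    simp only [this]
  rw [Finset.prod_congr rfl this]
  simp only [Fin.castSucc_lt_succ, if_true, lt_irrefl, if_false]
  ring

theorem eq_smul_leftField {n : ℕ} {ε : ℂ} {p v : Fin (n + 1) → ℂ} (hp : ∀ i, p i ≠ ε)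
    (hv : ∀ k : Fin n, v k.succ * (p k.castSucc - ε) + v k.castSucc * (p k.succ + ε) = 0) :
    ∃ c : ℂ, v = c • leftField ε p := by
  have h0 : leftField ε p 0 ≠ 0 := by
    unfold leftField
    refine Finset.prod_ne_zero_iff.2 fun j _ => ?_
    simpa [sub_eq_zero] using hp _
  refine ⟨v 0 / leftField ε p 0, ?_⟩
  ext i
  induction i using Fin.induction with
  | zero => simp [h0]
  | succ k ih =>
    have hne := sub_ne_zero.2 (hp k.castSucc)
    have h1 := leftField_rel ε p k
    have h2 := hv k
    apply mul_right_cancel₀ hne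
    simp only [Pi.smul_apply, smul_eq_mul] at ih ⊢
    rw [ih] at h2
    linear_combination h2 - v 0 / leftField ε p 0 * h1

theorem differentiable_leftField {n : ℕ} (ε : ℂ) :
    Differentiable ℂ (leftField ε : (Fin (n + 1) → ℂ) → Fin (n + 1) → ℂ) := by
  refine differentiable_pi.2 fun i => ?_
  unfold leftField
  refine (contDiff_prod (n := 1) fun j _ => ?_).differentiable one_ne_zero
  split_ifs <;> fun_prop

/-- The equation `d(H / P) v = 0`, for `v` along `leftField`, spreads from a neighbourhood of one
point to the whole domain: after clearing denominators it is a holomorphic identity. -/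
theorem fderiv_div_eq_zero_of_eventually {n : ℕ} {ε : ℂ} {D : Set (Fin (n + 1) → ℂ)}
    (hD : IsOpen D) (hD' : IsPreconnected D) {H P : (Fin (n + 1) → ℂ) → ℂ}
    (hH : DifferentiableOn ℂ H D) (hP : Differentiable ℂ P) {p₀ : Fin (n + 1) → ℂ} (hp₀ : p₀ ∈ D)
    (hPp₀ : P p₀ ≠ 0) (h : ∀ᶠ p in 𝓝 p₀, ∀ v : Fin (n + 1) → ℂ,
      (∀ k : Fin n, v k.succ * (p k.castSucc - ε) + v k.castSucc * (p k.succ + ε) = 0) →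
      fderiv ℂ (fun x => H x / P x) p v = 0) {p : Fin (n + 1) → ℂ} (hp : p ∈ D) (hPp : P p ≠ 0)
    (hpi : ∀ i, p i ≠ ε) {v : Fin (n + 1) → ℂ}
    (hv : ∀ k : Fin n, v k.succ * (p k.castSucc - ε) + v k.castSucc * (p k.succ + ε) = 0) :
    fderiv ℂ (fun x => H x / P x) p v = 0 := by
  have hfd : ∀ {f : (Fin (n + 1) → ℂ) → ℂ}, DifferentiableOn ℂ f D →
      DifferentiableOn ℂ (fderiv ℂ f) D := fun {f} hf => by
    have := (contDiffOn_succ_iff_fderiv_of_isOpen (n := 1) hD).1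
      (by rw [one_add_one_eq_two]; exact hf.contDiffOn_of_finiteDimensional hD 2)
    exact this.2.2.differentiableOn (by simp)
  have hw := (differentiable_leftField (n := n) ε).differentiableOn (s := D)
  have hΩ : DifferentiableOn ℂ (fun p => fderiv ℂ H p (leftField ε p) * P p -
      H p * fderiv ℂ P p (leftField ε p)) D :=
    (((hfd hH).clm_apply hw).mul hP.differentiableOn).sub
      (hH.mul ((hfd hP.differentiableOn).clm_apply hw))
  have hzero := hΩ.eqOn_zero_of_isPreconnected hD hD' hp₀ (by
    filter_upwards [h, hP.continuous.continuousAt.eventually_ne hPp₀, hD.mem_nhds hp₀]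
      with q h1 h2 h3
    have h4 := h1 _ (leftField_rel ε q)
    rw [fderiv_div_apply (hH.differentiableAt (hD.mem_nhds h3)) (hP q) h2] at h4
    simpa [h2] using h4)
  obtain ⟨c, rfl⟩ := eq_smul_leftField hpi hv
  rw [map_smul, fderiv_div_apply (hH.differentiableAt (hD.mem_nhds hp)) (hP p) hPp]
  have := hzero hp
  simp only [Pi.zero_apply] at this
  rw [this]
  simp

/-- On windows of length `n + 1`, a holomorphic function killed by both kinds of motions (those with
`(z (k+1) - 1) * (z k + 1)` fixed and those with `(z (k+1) + 1) * (z k - 1)` fixed) is locally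
constant. Entries `0`, `1` and `-1` are excluded. -/
def HasOnlyConstantInvariants (n : ℕ) : Prop :=
  ∀ (f : (Fin (n + 1) → ℂ) → ℂ) (O : Set (Fin (n + 1) → ℂ)), IsOpen O → DifferentiableOn ℂ f O →
    (∀ z ∈ O, ∀ i, z i ≠ 0 ∧ z i ^ 2 - 1 ≠ 0) →
    (∀ z ∈ O, ∀ v : Fin (n + 1) → ℂ, (∀ k : Fin n, v k.succ * (z k.castSucc + 1) +
      v k.castSucc * (z k.succ - 1) = 0) → fderiv ℂ f z v = 0) →
    (∀ z ∈ O, ∀ v : Fin (n + 1) → ℂ, (∀ k : Fin n, v k.succ * (z k.castSucc - 1) +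
      v k.castSucc * (z k.succ + 1) = 0) → fderiv ℂ f z v = 0) →
    ∀ z ∈ O, ∃ c, f =ᶠ[𝓝 z] fun _ => c

theorem hasOnlyConstantInvariants_four : HasOnlyConstantInvariants 4 :=
  fun _ _ hO hf hreg hV hW _ hz => exists_eventuallyEq_const hO hf
    (fun z hz => ⟨(hreg z hz 2).1, fun i => (hreg z hz i).2⟩) hV hW hz

/-- A function of three entries is regarded as a function of the middle part of a window of length
five. -/
theorem hasOnlyConstantInvariants_two : HasOnlyConstantInvariants 2 := by
  intro f O hO hf hreg hV hW z hz
  let π : (Fin 5 → ℂ) →L[ℂ] (Fin 3 → ℂ) := ContinuousLinearMap.pi fun i : Fin 3 =>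
    ContinuousLinearMap.proj (R := ℂ) (φ := fun _ : Fin 5 => ℂ) i.succ.castSucc
  have hπ : ∀ z i, π z i = z i.succ.castSucc := fun z i => rfl
  set O' : Set (Fin 5 → ℂ) := π ⁻¹' O ∩ {z | ∀ i, z i ≠ 0 ∧ z i ^ 2 - 1 ≠ 0} with hO'def
  have hO' : IsOpen O' := by
    refine (hO.preimage π.continuous).inter ?_
    simp only [ofPred_forall]
    refine isOpen_iInter_of_finite fun i => ?_
    exact (isOpen_ne_fun (continuous_apply i) continuous_const).inter
      (isOpen_ne_fun (by fun_prop) (by fun_prop))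
  have hfd : ∀ x ∈ O', DifferentiableAt ℂ f (π x) := fun x hx =>
    hf.differentiableAt (hO.mem_nhds hx.1)
  have hfderiv : ∀ x ∈ O', ∀ v, fderiv ℂ (f ∘ π) x v = fderiv ℂ f (π x) (π v) := fun x hx v => by
    rw [fderiv_comp x (hfd x hx) π.differentiableAt, π.fderiv]
    rfl
  -- The two added entries may have any value other than `0`, `1`, `-1`.
  let σ : (Fin 3 → ℂ) → Fin 5 → ℂ := fun x => ![2, x 0, x 1, x 2, 2]
  have hσ : Continuous σ := by
    refine continuous_pi fun i => ?_
    fin_cases i <;> simp [σ] <;> fun_prop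
  have hπσ : ∀ x, π (σ x) = x := fun x => by
    ext i
    rw [hπ]
    fin_cases i <;> rfl
  have hmem : σ z ∈ O' := by
    refine ⟨by rwa [mem_preimage, hπσ], fun i => ?_⟩
    have := hreg z hz
    fin_cases i
    · norm_num [σ]
    · exact this 0
    · exact this 1
    · exact this 2
    · norm_num [σ]
  obtain ⟨c, hc⟩ := hasOnlyConstantInvariants_four (f ∘ π) O' hO'
    (fun x hx => ((hfd x hx).comp x π.differentiableAt).differentiableWithinAt)
    (fun x hx => hx.2)
    (fun x hx v hv => by
      rw [hfderiv x hx]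
      exact hV _ hx.1 _ fun k => hv k.succ.castSucc)
    (fun x hx v hv => by
      rw [hfderiv x hx]
      exact hW _ hx.1 _ fun k => hv k.succ.castSucc) _ hmem
  refine ⟨c, ?_⟩
  filter_upwards [(hσ.tendsto z).eventually hc] with x hx
  simpa [hπσ] using hx

/-- If `g = H / P` satisfies `c * g p = g q` for linked windows near one pair, and `c ≠ 1`, then
`H = 0`: both kinds of motions kill `g`, so it is a constant `a` with `c * a = a`. -/
theorem eqOn_zero_of_linked {n : ℕ} (hn : HasOnlyConstantInvariants n) {β c : ℂ} (hβ : β ≠ 0)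
    (hc0 : c ≠ 0) (hc : c ≠ 1) {D : Set (Fin (n + 1) → ℂ)} (hD : IsOpen D)
    (hD' : IsPreconnected D) {H P : (Fin (n + 1) → ℂ) → ℂ} (hH : DifferentiableOn ℂ H D)
    (hP : Differentiable ℂ P) (hP0 : ∀ p, (∀ i, p i ≠ 1 ∧ p i ≠ -1) → P p ≠ 0)
    {p₀ q₀ : Fin (n + 1) → ℂ} (hp₀ : p₀ ∈ D) (hq₀ : q₀ ∈ D)
    (hpr : ∀ i, p₀ i ≠ 1 ∧ p₀ i ≠ -1) (hqr : ∀ i, q₀ i ≠ 1 ∧ q₀ i ≠ -1) (h : Linked 1 β p₀ q₀)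
    (hpq : ∀ᶠ pq in 𝓝 (p₀, q₀), Linked 1 β pq.1 pq.2 →
      c * (H pq.1 / P pq.1) = H pq.2 / P pq.2) : EqOn H 0 D := by
  have hreg : ∀ {x : Fin (n + 1) → ℂ}, (∀ i, x i ≠ 1 ∧ x i ≠ -1) →
      ∀ᶠ p in 𝓝 x, ∀ i, p i ≠ 1 ∧ p i ≠ -1 := fun {x} hx => eventually_all.2 fun i =>
    ((continuous_apply i).continuousAt.eventually_ne (hx i).1).and
      ((continuous_apply i).continuousAt.eventually_ne (hx i).2)
  have hdiff : ∀ {x}, x ∈ D → (∀ i, x i ≠ 1 ∧ x i ≠ -1) →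
      DifferentiableAt ℂ (fun x => H x / P x) x := fun {x} hx hr => by
    have h1 := hH.differentiableAt (hD.mem_nhds hx)
    have h2 := hP x
    have h3 := hP0 x hr
    simp only [div_eq_mul_inv]
    fun_prop (disch := assumption)
  have hdiffp : ∀ᶠ p in 𝓝 p₀, DifferentiableAt ℂ (fun x => H x / P x) p := by
    filter_upwards [hreg hpr, hD.mem_nhds hp₀] with p h1 h2 using hdiff h2 h1
  have hdiffq : ∀ᶠ p in 𝓝 q₀, DifferentiableAt ℂ (fun x => H x / P x) p := by
    filter_upwards [hreg hqr, hD.mem_nhds hq₀] with p h1 h2 using hdiff h2 h1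
  have hV := h.eventually_fderiv_right_eq_zero (fun i => (hpr i).1) (fun i => (hqr i).2)
    (f := fun x => c * (H x / P x)) hdiffq hpq
  have hW := h.eventually_fderiv_left_eq_zero hβ (fun i => (hpr i).1) (fun i => (hqr i).2)
    (g := fun x => c⁻¹ * (H x / P x)) hdiffp (hpq.mono fun pq h1 h2 => by
      rw [← h1 h2, inv_mul_cancel_left₀ hc0])
  obtain ⟨O₀, hO₀, hO₀o, hqO₀⟩ :=
    _root_.eventually_nhds_iff.1 (hV.and ((hreg hqr).and (hD.mem_nhds hq₀)))
  have hdense : Dense {z : Fin (n + 1) → ℂ | ∀ i, z i ≠ 0} := by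
    have := dense_pi (Set.univ : Set (Fin (n + 1))) (s := fun _ => ({0}ᶜ : Set ℂ))
      fun i _ => dense_compl_singleton 0
    convert this using 1
    ext z; simp [Set.mem_pi]
  have hopen : IsOpen {z : Fin (n + 1) → ℂ | ∀ i, z i ≠ 0} := by
    simp only [ofPred_forall]
    exact isOpen_iInter_of_finite fun i => isOpen_ne_fun (continuous_apply i) continuous_const
  -- A generic point near `q₀`, where both kinds of motions are available.
  obtain ⟨z, hz⟩ := hdense.inter_open_nonempty O₀ hO₀o ⟨q₀, hqO₀⟩
  obtain ⟨a, ha⟩ := hn (fun x => H x / P x) (O₀ ∩ {z | ∀ i, z i ≠ 0}) (hO₀o.inter hopen)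
    (fun x hx => (hdiff (hO₀ x hx.1).2.2 (hO₀ x hx.1).2.1).differentiableWithinAt)
    (fun x hx i => ⟨hx.2 i, fun h0 => by
      have h1 := (hO₀ x hx.1).2.1 i
      rw [show x i ^ 2 - 1 = (x i - 1) * (x i + 1) by ring, mul_eq_zero, sub_eq_zero] at h0
      exact h0.elim h1.1 fun h => h1.2 (eq_neg_of_add_eq_zero_left h)⟩)
    (fun x hx => (hO₀ x hx.1).1)
    (fun x hx v hv => fderiv_div_eq_zero_of_eventually hD hD' hH hP hp₀ (hP0 _ hpr) hW
      (hO₀ x hx.1).2.2 (hP0 _ (hO₀ x hx.1).2.1) (fun i => ((hO₀ x hx.1).2.1 i).1) hv) z hz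
  have hzD := (hO₀ z hz.1).2.2
  have heq : ∀ x ∈ D, H x = a * P x := by
    intro x hx
    have hd : DifferentiableOn ℂ (fun x => H x - a * P x) D :=
      hH.sub (hP.differentiableOn.const_mul a)
    refine sub_eq_zero.1 (hd.eqOn_zero_of_isPreconnected hD hD' hzD ?_ hx)
    filter_upwards [ha, hreg (hO₀ z hz.1).2.1] with y h1 h2
    simp only [← h1, Pi.zero_apply, div_mul_cancel₀ _ (hP0 y h2), sub_self]
  have h1 := hpq.self_of_nhds h
  simp only [heq _ hp₀, heq _ hq₀, mul_div_cancel_right₀ _ (hP0 _ hpr),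
    mul_div_cancel_right₀ _ (hP0 _ hqr)] at h1
  have ha0 : a = 0 := by
    by_contra h0
    exact hc (mul_right_cancel₀ h0 (by rw [h1, one_mul]))
  intro x hx
  simp [heq x hx, ha0]

/-! ### Extending a strip to a global solution -/

/-- In a group, a bi-infinite sequence with prescribed ratios exists; it is an orbit of the
permutation `(m, g) ↦ (m + 1, a m * g)` of `ℤ × G`. -/
theorem exists_int_product {G : Type*} [Group G] (a : ℤ → G) :
    ∃ F : ℤ → G, ∀ m, F (m + 1) = a m * F m := by
  let T : Equiv.Perm (ℤ × G) :=
    { toFun := fun x => (x.1 + 1, a x.1 * x.2)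
      invFun := fun x => (x.1 - 1, (a (x.1 - 1))⁻¹ * x.2)
      left_inv := fun x => by simp
      right_inv := fun x => by simp }
  have hT : ∀ x, T x = (x.1 + 1, a x.1 * x.2) := fun _ => rfl
  have hstep : ∀ m : ℤ, (T ^ (m + 1)) (0, 1) = T ((T ^ m) (0, 1)) := fun m => by
    rw [zpow_add_one, (Commute.refl T).zpow_left m |>.eq, Equiv.Perm.mul_apply]
  have hfst : ∀ m : ℤ, ((T ^ m) (0, 1)).1 = m := by
    intro m
    induction m using Int.induction_on with
    | zero => simp
    | succ k ih => rw [hstep, hT, ih]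
    | pred k ih =>
      have h := hstep (-(k : ℤ) - 1)
      rw [sub_add_cancel] at h
      rw [h, hT] at ih
      simp only at ih
      linarith
  refine ⟨fun m => ((T ^ m) (0, 1)).2, fun m => ?_⟩
  beta_reduce
  rw [hstep, hT, hfst]

/-- With `y m + 1 = ψ (m+1) / ψ m` the recursion becomes the linear one
`ψ (m+2) = 2 * ψ (m+1) + a m * ψ m`. For all but countably many initial values no `ψ m`
vanishes. -/
theorem exists_riccati_orbit {a : ℤ → ℂ} (ha : ∀ m, a m ≠ 0) :
    ∃ y : ℤ → ℂ, ∀ m, (y (m + 1) - 1) * (y m + 1) = a m := by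
  let e : ℤ → (ℂ × ℂ) ≃ₗ[ℂ] (ℂ × ℂ) := fun m =>
    { toFun := fun v => (v.2, 2 * v.2 + a m * v.1)
      invFun := fun v => ((v.2 - 2 * v.1) / a m, v.1)
      map_add' := fun v w => by ext <;> simp; ring
      map_smul' := fun c v => by ext <;> simp; ring
      left_inv := fun v => by ext <;> simp [ha m]
      right_inv := fun v => by ext <;> simp [mul_div_cancel₀ _ (ha m)] }
  obtain ⟨F, hF⟩ := exists_int_product e
  have hstep : ∀ m v, F (m + 1) v = ((F m v).2, 2 * (F m v).2 + a m * (F m v).1) := by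
    intro m v
    rw [hF]
    rfl
  have hsub : ∀ m, {s : ℂ | (F m (s, 1)).1 = 0}.Subsingleton := by
    intro m s hs t ht
    by_contra hst
    have hst' : s - t ≠ 0 := sub_ne_zero.2 hst
    simp only [mem_ofPred_eq] at hs ht
    have h1 : ∀ v : ℂ × ℂ, (F m v).1 = 0 := by
      intro v
      have hv : v = ((v.1 - v.2 * t) / (s - t)) • ((s, 1) - (t, 1) : ℂ × ℂ) + v.2 • (t, 1) := by
        ext
        · simp [hst']
        · simp
      rw [hv, map_add, map_smul, map_sub, map_smul]
      simp [hs, ht]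
    obtain ⟨v, hv⟩ := (F m).surjective (1, 0)
    have := h1 v
    rw [hv] at this
    simp at this
  have hcount : (⋃ m, {s : ℂ | (F m (s, 1)).1 = 0}).Countable :=
    countable_iUnion fun m => (hsub m).countable
  obtain ⟨s, hs⟩ := (hcount.dense_compl ℂ).nonempty
  have hs' : ∀ m, (F m (s, 1)).1 ≠ 0 := by simpa using hs
  refine ⟨fun m => (F (m + 1) (s, 1)).1 / (F m (s, 1)).1 - 1, fun m => ?_⟩
  have h0 := hs' m
  have h1 := hs' (m + 1)
  have h2 : (F (m + 1 + 1) (s, 1)).1 = 2 * (F (m + 1) (s, 1)).1 + a m * (F m (s, 1)).1 := by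
    rw [hstep, hstep]
  beta_reduce
  rw [h2]
  field_simp
  ring

/-- A finite chain for a relation in which every element has a successor and a predecessor extends
to a bi-infinite chain. -/
theorem exists_int_chain {α : Type*} {r : α → α → Prop} (hs : ∀ a, ∃ b, r a b)
    (hp : ∀ b, ∃ a, r a b) {K : ℕ} {w : ℕ → α} (hw : ∀ k < K, r (w k) (w (k + 1))) :
    ∃ U : ℤ → α, (∀ m, r (U m) (U (m + 1))) ∧ ∀ k : ℕ, k ≤ K → U k = w k := by
  choose S hS using hs
  choose P hP using hp
  let w' : ℕ → α := fun k => if k ≤ K then w k else S^[k - K] (w K)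
  have hw' : ∀ k, r (w' k) (w' (k + 1)) := by
    intro k
    simp only [w']
    rcases lt_trichotomy k K with h | rfl | h
    · rw [if_pos h.le, if_pos (by omega)]
      exact hw k h
    · rw [if_pos le_rfl, if_neg (by omega), Nat.add_sub_cancel_left]
      exact hS _
    · rw [if_neg (by omega), if_neg (by omega), show k + 1 - K = (k - K) + 1 by omega,
        Function.iterate_succ_apply']
      exact hS _
  let U : ℤ → α := fun m =>
    match m with
    | Int.ofNat k => w' k
    | Int.negSucc j => P^[j + 1] (w 0)
  refine ⟨U, fun m => ?_, fun k hk => ?_⟩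
  · match m with
    | Int.ofNat k => exact hw' k
    | Int.negSucc 0 =>
      change r (P (w 0)) (w' 0)
      simp only [w', Nat.zero_le, if_true]
      exact hP _
    | Int.negSucc (j + 1) =>
      have : Int.negSucc (j + 1) + 1 = Int.negSucc j := by omega
      rw [this]
      change r (P^[j + 1 + 1] (w 0)) (P^[j + 1] (w 0))
      rw [Function.iterate_succ_apply' P (j + 1)]
      exact hP _
  · change w' k = w k
    simp [w', hk]

/-- Columns `u n ·` without the values `1` and `-1`. -/
def RegularColumn : Type := {x : ℤ → ℂ // ∀ m, x m ≠ 1 ∧ x m ≠ -1}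

/-- The discrete equation between two neighbouring columns. -/
def ColumnRel (β : ℂ) (x y : RegularColumn) : Prop :=
  ∀ m, (x.1 (m + 1) + 1) * (x.1 m - 1) = β * ((y.1 (m + 1) - 1) * (y.1 m + 1))

theorem ne_of_prod_ne_zero {y : ℤ → ℂ} (h : ∀ m, (y (m + 1) - 1) * (y m + 1) ≠ 0) (m : ℤ) :
    y m ≠ 1 ∧ y m ≠ -1 := by
  constructor
  · have := left_ne_zero_of_mul (h (m - 1))
    rwa [sub_add_cancel, sub_ne_zero] at this
  · have := right_ne_zero_of_mul (h m)
    exact fun h0 => this (by rw [h0]; ring)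

theorem RegularColumn.prod_ne_zero (x : RegularColumn) (m : ℤ) :
    (x.1 (m + 1) + 1) * (x.1 m - 1) ≠ 0 ∧ (x.1 (m + 1) - 1) * (x.1 m + 1) ≠ 0 := by
  have h1 := x.2 m
  have h2 := x.2 (m + 1)
  exact ⟨mul_ne_zero (fun h => h2.2 (eq_neg_of_add_eq_zero_left h)) (sub_ne_zero.2 h1.1),
    mul_ne_zero (sub_ne_zero.2 h2.1) (fun h => h1.2 (eq_neg_of_add_eq_zero_left h))⟩

theorem exists_columnRel_right {β : ℂ} (hβ : β ≠ 0) (x : RegularColumn) :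
    ∃ y, ColumnRel β x y := by
  have ha : ∀ m, (x.1 (m + 1) + 1) * (x.1 m - 1) / β ≠ 0 := fun m =>
    div_ne_zero (x.prod_ne_zero m).1 hβ
  obtain ⟨y, hy⟩ := exists_riccati_orbit ha
  refine ⟨⟨y, ne_of_prod_ne_zero fun m => by rw [hy]; exact ha m⟩, fun m => ?_⟩
  change _ = β * ((y (m + 1) - 1) * (y m + 1))
  rw [hy, mul_div_cancel₀ _ hβ]

theorem exists_columnRel_left {β : ℂ} (hβ : β ≠ 0) (y : RegularColumn) :
    ∃ x, ColumnRel β x y := by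
  have ha : ∀ m, β * ((y.1 (m + 1) - 1) * (y.1 m + 1)) ≠ 0 := fun m =>
    mul_ne_zero hβ (y.prod_ne_zero m).2
  obtain ⟨x, hx⟩ := exists_riccati_orbit ha
  have hr := ne_of_prod_ne_zero (y := x) fun m => by rw [hx]; exact ha m
  refine ⟨⟨fun m => -x m, fun m => ⟨fun h => (hr m).2 (by rw [← h, neg_neg]),
    fun h => (hr m).1 (neg_injective h)⟩⟩, fun m => ?_⟩
  rw [← hx]
  ring

/-- Pairs `(u n m, u (n+1) m)` without the values `1` and `-1`. -/
def RegularPair : Type := {x : ℂ × ℂ // (x.1 ≠ 1 ∧ x.1 ≠ -1) ∧ (x.2 ≠ 1 ∧ x.2 ≠ -1)}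

/-- The discrete equation between two consecutive rows of a pair of columns. -/
def PairRel (β : ℂ) (x y : RegularPair) : Prop :=
  (y.1.1 + 1) * (x.1.1 - 1) = β * ((y.1.2 - 1) * (x.1.2 + 1))

theorem exists_scale {a b : ℂ} (ha : a ≠ 0) (hb : b ≠ 0) (c : ℂ) :
    ∃ t : ℂ, t ≠ 0 ∧ t * a ≠ c ∧ t * b ≠ -c := by
  obtain ⟨t, ht⟩ := Infinite.exists_notMem_finset ({0, c / a, -c / b} : Finset ℂ)
  simp only [Finset.mem_insert, Finset.mem_singleton, not_or] at ht
  exact ⟨t, ht.1, fun h => ht.2.1 (by rw [← h, mul_div_cancel_right₀ _ ha]),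
    fun h => ht.2.2 (by rw [← h, mul_div_cancel_right₀ _ hb])⟩

theorem exists_pairRel_succ {β : ℂ} (hβ : β ≠ 0) (x : RegularPair) : ∃ y, PairRel β x y := by
  have hp : x.1.1 - 1 ≠ 0 := sub_ne_zero.2 x.2.1.1
  have hq : β * (x.1.2 + 1) ≠ 0 :=
    mul_ne_zero hβ fun h => x.2.2.2 (eq_neg_of_add_eq_zero_left h)
  obtain ⟨t, h0, h1, h2⟩ := exists_scale hq hp 2
  refine ⟨⟨(-1 + t * (β * (x.1.2 + 1)), 1 + t * (x.1.1 - 1)), ⟨fun h => h1 ?_, fun h => ?_⟩,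
    ⟨fun h => ?_, fun h => h2 ?_⟩⟩, ?_⟩
  · linear_combination h
  · exact mul_ne_zero h0 hq (by linear_combination h)
  · exact mul_ne_zero h0 hp (by linear_combination h)
  · linear_combination h
  · simp only [PairRel]
    ring

theorem exists_pairRel_pred {β : ℂ} (hβ : β ≠ 0) (y : RegularPair) : ∃ x, PairRel β x y := by
  have hp : y.1.1 + 1 ≠ 0 := fun h => y.2.1.2 (eq_neg_of_add_eq_zero_left h)
  have hq : β * (y.1.2 - 1) ≠ 0 := mul_ne_zero hβ (sub_ne_zero.2 y.2.2.1)
  obtain ⟨t, h0, h1, h2⟩ := exists_scale hp hq 2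
  refine ⟨⟨(1 + t * (β * (y.1.2 - 1)), -1 + t * (y.1.1 + 1)), ⟨fun h => ?_, fun h => h2 ?_⟩,
    ⟨fun h => h1 ?_, fun h => ?_⟩⟩, ?_⟩
  · exact mul_ne_zero h0 hq (by linear_combination h)
  · linear_combination h
  · linear_combination h
  · exact mul_ne_zero h0 hp (by linear_combination h)
  · simp only [PairRel]
    ring

/-- Linked regular windows are part of a global solution: the strip of two columns is first extended
up and down, and then to the left and right. -/
theorem Linked.exists_isSolution {n : ℕ} {β : ℂ} (hβ : β ≠ 0) {x y : Fin (n + 1) → ℂ}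
    (h : Linked 1 β x y) (hx : ∀ i, x i ≠ 1 ∧ x i ≠ -1) (hy : ∀ i, y i ≠ 1 ∧ y i ≠ -1) :
    ∃ u : ℤ → ℤ → ℂ, (betaEquation β).IsSolution u ∧
      ∀ i : Fin (n + 1), u 0 (i : ℕ) = x i ∧ u 1 (i : ℕ) = y i := by
  let w : ℕ → RegularPair := fun k =>
    ⟨(x (Fin.ofNat (n + 1) k), y (Fin.ofNat (n + 1) k)), hx _, hy _⟩
  have hw : ∀ k < n, PairRel β (w k) (w (k + 1)) := by
    intro k hk
    have := h ⟨k, hk⟩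
    have e1 : Fin.ofNat (n + 1) k = (⟨k, hk⟩ : Fin n).castSucc := by
      ext; simp [Nat.mod_eq_of_lt (by omega : k < n + 1)]
    have e2 : Fin.ofNat (n + 1) (k + 1) = (⟨k, hk⟩ : Fin n).succ := by
      ext; simp [Nat.mod_eq_of_lt (by omega : k + 1 < n + 1)]
    simp only [PairRel, w, e1, e2]
    exact this
  obtain ⟨U, hU, hUw⟩ := exists_int_chain (exists_pairRel_succ hβ) (exists_pairRel_pred hβ) hw
  let X : RegularColumn := ⟨fun m => (U m).1.1, fun m => (U m).2.1⟩
  let Y : RegularColumn := ⟨fun m => (U m).1.2, fun m => (U m).2.2⟩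
  let c : ℕ → RegularColumn := fun k => if k = 0 then X else Y
  have hc : ∀ k < 1, ColumnRel β (c k) (c (k + 1)) := by
    intro k hk
    obtain rfl : k = 0 := by omega
    exact fun m => hU m
  obtain ⟨V, hV, hVc⟩ := exists_int_chain (exists_columnRel_right hβ) (exists_columnRel_left hβ) hc
  refine ⟨fun n m => (V n).1 m, fun n m => ?_, fun i => ?_⟩
  · exact sub_eq_zero.2 (hV n m)
  · have e : Fin.ofNat (n + 1) (i : ℕ) = i := by ext; simp
    have h0 : V 0 = X := hVc 0 (by omega)
    have h1 : V 1 = Y := hVc 1 le_rfl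
    have hi := hUw i (by omega)
    simp only [h0, h1, X, Y, hi, w, e, and_self]

/-! ### The leading coefficient of a symmetry -/

theorem betaEquation_d00 (β a b c d : ℂ) : (betaEquation β).d00 a b c d = c + 1 := by
  have : HasDerivAt (fun z => (c + 1) * (z - 1) - β * ((d - 1) * (b + 1))) (c + 1) a := by
    simpa using (((hasDerivAt_id a).sub_const 1).const_mul (c + 1)).sub_const
      (β * ((d - 1) * (b + 1)))
  exact this.deriv

theorem betaEquation_d01 (β a b c d : ℂ) : (betaEquation β).d01 a b c d = a - 1 := by
  have : HasDerivAt (fun z => (z + 1) * (a - 1) - β * ((d - 1) * (b + 1))) (a - 1) c := by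
    simpa using (((hasDerivAt_id c).add_const 1).mul_const (a - 1)).sub_const
      (β * ((d - 1) * (b + 1)))
  exact this.deriv

theorem betaEquation_d10 (β a b c d : ℂ) : (betaEquation β).d10 a b c d = -β * (d - 1) := by
  have : HasDerivAt (fun z => (c + 1) * (a - 1) - β * ((d - 1) * (z + 1))) (-β * (d - 1)) b := by
    simpa using ((((hasDerivAt_id b).add_const 1).const_mul (d - 1)).const_mul β).const_sub
      ((c + 1) * (a - 1))
  exact this.deriv

theorem betaEquation_d11 (β a b c d : ℂ) : (betaEquation β).d11 a b c d = -β * (b + 1) := by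
  have : HasDerivAt (fun z => (c + 1) * (a - 1) - β * ((z - 1) * (b + 1))) (-β * (b + 1)) d := by
    simpa using ((((hasDerivAt_id d).sub_const 1).mul_const (b + 1)).const_mul β).const_sub
      ((c + 1) * (a - 1))
  exact this.deriv

theorem betaEquation_isRegularSolution_iff {β : ℂ} (hβ : β ≠ 0) {u : ℤ → ℤ → ℂ} :
    (betaEquation β).IsRegularSolution u ↔
      (betaEquation β).IsSolution u ∧ ∀ n m, u n m ≠ 1 ∧ u n m ≠ -1 := by
  simp only [QuadFun.IsRegularSolution, betaEquation_d00, betaEquation_d01, betaEquation_d10,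
    betaEquation_d11]
  refine and_congr_right fun _ => ⟨fun h n m => ⟨?_, ?_⟩, fun h n m => ?_⟩
  · exact sub_ne_zero.1 (h n m).2.2.1
  · have := (h n (m - 1)).1
    rw [sub_add_cancel] at this
    exact fun h0 => this (by rw [h0]; ring)
  · have h1 : ∀ n m, u n m + 1 ≠ 0 := fun n m h0 => (h n m).2 (eq_neg_of_add_eq_zero_left h0)
    have h2 : ∀ n m, u n m - 1 ≠ 0 := fun n m => sub_ne_zero.2 (h n m).1
    exact ⟨h1 _ _, mul_ne_zero (neg_ne_zero.2 hβ) (h2 _ _), h2 _ _,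
      mul_ne_zero (neg_ne_zero.2 hβ) (h1 _ _)⟩

section Nonexistence

variable {β : ℂ} {μ : ℕ} {D : ℤ → ℤ → Set (Fin (2 * μ + 1) → ℂ)}
  {h : ℤ → ℤ → (Fin (2 * μ + 1) → ℂ) → ℂ}

/-- The compatibility condition on linked windows of length `2 * μ + 2`. The symmetry being
autonomous, the windows may be placed anywhere on the lattice; index `0` is put in row `0`. -/
theorem IsCompatibleM.compat_of_linked (hβ : β ≠ 0) (hc : IsCompatibleM (betaEquation β) μ D h)
    (ha : IsAutonomous D h) {x y : Fin (2 * μ + 1 + 1) → ℂ} (hxy : Linked 1 β x y)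
    (hx : ∀ i, x i ≠ 1 ∧ x i ≠ -1) (hy : ∀ i, y i ≠ 1 ∧ y i ≠ -1)
    (hx0 : Fin.init x ∈ D 0 0) (hx1 : Fin.tail x ∈ D 0 0)
    (hy0 : Fin.init y ∈ D 0 0) (hy1 : Fin.tail y ∈ D 0 0) :
    h 0 0 (Fin.init x) * (x ⟨μ + 1, by omega⟩ + 1) + h 0 0 (Fin.tail x) * (x ⟨μ, by omega⟩ - 1) -
      β * (h 0 0 (Fin.init y) * (y ⟨μ + 1, by omega⟩ - 1) +
        h 0 0 (Fin.tail y) * (y ⟨μ, by omega⟩ + 1)) = 0 := by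
  obtain ⟨u, hu, hux⟩ := hxy.exists_isSolution hβ hx hy
  have w0 : ∀ n, mWindow μ u n μ = fun k : Fin (2 * μ + 1) => u n (k : ℕ) := fun n => by
    ext k; simp [mWindow]
  have w1 : ∀ n, mWindow μ u n (μ + 1) =
      fun k : Fin (2 * μ + 1) => u n (((k : ℕ) + 1 : ℕ) : ℤ) := fun n => by
    ext k
    simp only [mWindow]
    congr 1
    push_cast
    ring
  have e1 : mWindow μ u 0 μ = Fin.init x := by
    rw [w0]; ext k; exact (hux k.castSucc).1
  have e2 : mWindow μ u (0 + 1) μ = Fin.init y := by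
    rw [w0]; ext k; exact (hux k.castSucc).2
  have e3 : mWindow μ u 0 (μ + 1) = Fin.tail x := by
    rw [w1]; ext k; exact (hux k.succ).1
  have e4 : mWindow μ u (0 + 1) (μ + 1) = Fin.tail y := by
    rw [w1]; ext k; exact (hux k.succ).2
  have key := hc.compatible u hu 0 μ ⟨by rwa [e1, (ha _ _).1], by rwa [e2, (ha _ _).1],
    by rwa [e3, (ha _ _).1], by rwa [e4, (ha _ _).1]⟩
  rw [e1, e2, e3, e4, (ha _ _).2 hx0, (ha _ _).2 hy0, (ha _ _).2 hx1, (ha _ _).2 hy1,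
    betaEquation_d00, betaEquation_d01, betaEquation_d10, betaEquation_d11] at key
  have f1 := hux ⟨μ, by omega⟩
  have f2 := hux ⟨μ + 1, by omega⟩
  simp only [Nat.cast_add, Nat.cast_one] at f1 f2
  rw [zero_add, f1.1, f1.2, f2.1, f2.2] at key
  linear_combination key

theorem IsCompatibleM.exists_linked (hβ : β ≠ 0) (hc : IsCompatibleM (betaEquation β) μ D h)
    (ha : IsAutonomous D h) : ∃ x y : Fin (2 * μ + 1 + 1) → ℂ, Linked 1 β x y ∧
    (∀ i, x i ≠ 1 ∧ x i ≠ -1) ∧ (∀ i, y i ≠ 1 ∧ y i ≠ -1) ∧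
    Fin.init x ∈ D 0 0 ∧ Fin.tail x ∈ D 0 0 ∧ Fin.init y ∈ D 0 0 ∧ Fin.tail y ∈ D 0 0 := by
  obtain ⟨u, hu, h1, h2, h3, h4⟩ := hc.nonvoid 0 0
  rw [betaEquation_isRegularSolution_iff hβ] at hu
  rw [(ha _ _).1] at h2 h3 h4
  have et : ∀ n, Fin.tail (fun k : Fin (2 * μ + 1 + 1) => u n (((k : ℕ) : ℤ) - μ)) =
      mWindow μ u n (0 + 1) := fun n => by
    ext k
    simp only [Fin.tail, mWindow, Fin.val_succ]
    congr 1
    push_cast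
    ring
  have ei : ∀ n, Fin.init (fun k : Fin (2 * μ + 1 + 1) => u n (((k : ℕ) : ℤ) - μ)) =
      mWindow μ u n 0 := fun n => by
    ext k
    simp [Fin.init, mWindow]
  refine ⟨fun k => u 0 (((k : ℕ) : ℤ) - μ), fun k => u 1 (((k : ℕ) : ℤ) - μ), fun k => ?_,
    fun i => hu.2 _ _, fun i => hu.2 _ _, ?_, ?_, ?_, ?_⟩
  · have := sub_eq_zero.1 (hu.1 0 (((k : ℕ) : ℤ) - μ))
    have e : (((k.succ : Fin (2 * μ + 1 + 1)) : ℕ) : ℤ) - μ = ((k : ℕ) : ℤ) - μ + 1 := by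
      simp; ring
    simp only [e]
    exact this
  · rwa [ei]
  · rwa [et]
  · rw [ei]; exact h2
  · rw [et]; exact h4

/-- The derivative of the compatibility condition in the topmost values of the two columns. The
lowest entries of the longer windows are recovered from `pq` by `X` and `Y`: in the left column the
entry is kept fixed, in the right column it is solved for. -/
theorem IsCompatibleM.eventually_fderiv_last (hβ : β ≠ 0) (hμ : 0 < μ)
    (hc : IsCompatibleM (betaEquation β) μ D h) (ha : IsAutonomous D h)
    {x y : Fin (2 * μ + 1 + 1) → ℂ} (hxy : Linked 1 β x y)
    (hx : ∀ i, x i ≠ 1 ∧ x i ≠ -1) (hy : ∀ i, y i ≠ 1 ∧ y i ≠ -1)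
    (hx0 : Fin.init x ∈ D 0 0) (hx1 : Fin.tail x ∈ D 0 0)
    (hy0 : Fin.init y ∈ D 0 0) (hy1 : Fin.tail y ∈ D 0 0) :
    ∀ᶠ pq in 𝓝 (Fin.tail x, Fin.tail y), Linked 1 β pq.1 pq.2 →
      fderiv ℂ (h 0 0) pq.1 (Pi.single (Fin.last (2 * μ)) 1) *
          (pq.1 ⟨μ - 1, by omega⟩ - 1) * (pq.2 ⟨2 * μ - 1, by omega⟩ + 1) =
        fderiv ℂ (h 0 0) pq.2 (Pi.single (Fin.last (2 * μ)) 1) *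
          (pq.2 ⟨μ - 1, by omega⟩ + 1) * (pq.1 ⟨2 * μ - 1, by omega⟩ - 1) := by
  let c : (Fin (2 * μ + 1) → ℂ) × (Fin (2 * μ + 1) → ℂ) → ℂ := fun pq =>
    -1 + (pq.1 0 + 1) * (x 0 - 1) / (β * (pq.2 0 - 1))
  let X : (Fin (2 * μ + 1) → ℂ) × (Fin (2 * μ + 1) → ℂ) → Fin (2 * μ + 1 + 1) → ℂ :=
    fun pq => Fin.cons (x 0) pq.1
  let Y : (Fin (2 * μ + 1) → ℂ) × (Fin (2 * μ + 1) → ℂ) → Fin (2 * μ + 1 + 1) → ℂ :=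
    fun pq => Fin.cons (c pq) pq.2
  have hlink0 := hxy 0
  have hy10 : y (Fin.succ 0) - 1 ≠ 0 := sub_ne_zero.2 (hy _).1
  have hX0 : X (Fin.tail x, Fin.tail y) = x := Fin.cons_self_tail x
  have hc0 : c (Fin.tail x, Fin.tail y) = y 0 := by
    simp only [c, Fin.tail]
    have : β * (y (Fin.succ 0) - 1) ≠ 0 := mul_ne_zero hβ hy10
    have h2 : (x (Fin.succ 0) + 1) * (x 0 - 1) = (y 0 + 1) * (β * (y (Fin.succ 0) - 1)) := by
      rw [show (0 : Fin (2 * μ + 1 + 1)) = Fin.castSucc 0 from rfl, hlink0]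
      ring
    rw [h2, mul_div_cancel_right₀ _ this]
    ring
  have hY0 : Y (Fin.tail x, Fin.tail y) = y := by
    simp only [Y, hc0]
    exact Fin.cons_self_tail y
  have hcc : ContinuousAt c (Fin.tail x, Fin.tail y) := by
    have : β * ((Fin.tail x, Fin.tail y).2 0 - 1) ≠ 0 := mul_ne_zero hβ hy10
    exact continuousAt_const.add (ContinuousAt.div (by fun_prop) (by fun_prop) this)
  have hXc : ContinuousAt X (Fin.tail x, Fin.tail y) := by
    refine continuousAt_pi.2 fun i => ?_
    cases i using Fin.cases with
    | zero => exact continuousAt_const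
    | succ k => simp only [X, Fin.cons_succ]; fun_prop
  have hYc : ContinuousAt Y (Fin.tail x, Fin.tail y) := by
    refine continuousAt_pi.2 fun i => ?_
    cases i using Fin.cases with
    | zero => exact hcc
    | succ k => simp only [Y, Fin.cons_succ]; fun_prop
  have hinit : Continuous (Fin.init : (Fin (2 * μ + 1 + 1) → ℂ) → Fin (2 * μ + 1) → ℂ) :=
    continuous_pi fun i => continuous_apply _
  have hD := hc.isOpen 0 0
  have hreg : ∀ {x : Fin (2 * μ + 1 + 1) → ℂ}, (∀ i, x i ≠ 1 ∧ x i ≠ -1) →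
      ∀ᶠ p in 𝓝 x, ∀ i, p i ≠ 1 ∧ p i ≠ -1 := fun {x} hx => eventually_all.2 fun i =>
    ((continuous_apply i).continuousAt.eventually_ne (hx i).1).and
      ((continuous_apply i).continuousAt.eventually_ne (hx i).2)
  have hXe : ∀ᶠ pq in 𝓝 (Fin.tail x, Fin.tail y),
      (∀ i, X pq i ≠ 1 ∧ X pq i ≠ -1) ∧ Fin.init (X pq) ∈ D 0 0 := by
    rw [ContinuousAt, hX0] at hXc
    exact hXc.eventually ((hreg hx).and (hinit.continuousAt.preimage_mem_nhds (hD.mem_nhds hx0)))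
  have hYe : ∀ᶠ pq in 𝓝 (Fin.tail x, Fin.tail y),
      (∀ i, Y pq i ≠ 1 ∧ Y pq i ≠ -1) ∧ Fin.init (Y pq) ∈ D 0 0 := by
    rw [ContinuousAt, hY0] at hYc
    exact hYc.eventually ((hreg hy).and (hinit.continuousAt.preimage_mem_nhds (hD.mem_nhds hy0)))
  have hE : ∀ᶠ pq in 𝓝 (Fin.tail x, Fin.tail y), pq.1 ∈ D 0 0 ∧ pq.2 ∈ D 0 0 ∧
      (∀ i, X pq i ≠ 1 ∧ X pq i ≠ -1) ∧ (∀ i, Y pq i ≠ 1 ∧ Y pq i ≠ -1) ∧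
      Fin.init (X pq) ∈ D 0 0 ∧ Fin.init (Y pq) ∈ D 0 0 := by
    filter_upwards [hXe, hYe, continuous_fst.continuousAt.preimage_mem_nhds (hD.mem_nhds hx1),
      continuous_snd.continuousAt.preimage_mem_nhds (hD.mem_nhds hy1)] with pq h1 h2 h3 h4
    exact ⟨h3, h4, h1.1, h2.1, h1.2, h2.2⟩
  filter_upwards [hE.eventually_nhds] with ⟨p, q⟩ hpq hl
  have hpq0 := hpq.self_of_nhds
  set last := Fin.last (2 * μ) with hlast
  -- The equation is affine in the topmost values, so these move along a line through `(p, q)` that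
  -- consists of linked windows.
  set a : ℂ := β * (q ⟨2 * μ - 1, by omega⟩ + 1) with ha'
  set b : ℂ := p ⟨2 * μ - 1, by omega⟩ - 1 with hb'
  let pt : ℂ → Fin (2 * μ + 1) → ℂ := fun t => p + t • Pi.single last a
  let qt : ℂ → Fin (2 * μ + 1) → ℂ := fun t => q + t • Pi.single last b
  have hpt : ∀ t i, i ≠ last → pt t i = p i := fun t i hi => by simp [pt, hi]
  have hqt : ∀ t i, i ≠ last → qt t i = q i := fun t i hi => by simp [qt, hi]
  have hpl : ∀ t, pt t last = p last + t * a := fun t => by simp [pt]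
  have hql : ∀ t, qt t last = q last + t * b := fun t => by simp [qt]
  have hcs : ∀ k : Fin (2 * μ), k.castSucc ≠ last := fun k => (Fin.castSucc_lt_last k).ne
  have hlt : ∀ t, Linked 1 β (pt t) (qt t) := by
    intro t k
    have hk := hl k
    simp only at hk
    rw [hpt t _ (hcs k), hqt t _ (hcs k)]
    by_cases hkl : k.succ = last
    · have e : (⟨2 * μ - 1, by omega⟩ : Fin (2 * μ + 1)) = k.castSucc := by
        have := congrArg Fin.val hkl
        ext
        simp [hlast] at this ⊢
        omega
      rw [e] at ha' hb'
      rw [hkl] at hk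
      rw [hkl, hpl, hql, ha', hb']
      linear_combination hk
    · rw [hpt t _ hkl, hqt t _ hkl]
      exact hk
  have h0last : (0 : Fin (2 * μ + 1)) ≠ last := by
    intro h0
    have := congrArg Fin.val h0
    simp [hlast] at this
    omega
  have hXi : ∀ t, Fin.init (X (pt t, qt t)) = Fin.init (X (p, q)) := by
    intro t
    ext i
    simp only [Fin.init, X]
    cases i using Fin.cases with
    | zero => rfl
    | succ k =>
      rw [← Fin.succ_castSucc, Fin.cons_succ, Fin.cons_succ, hpt t _ (hcs k)]
  have hYi : ∀ t, Fin.init (Y (pt t, qt t)) = Fin.init (Y (p, q)) := by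
    intro t
    ext i
    simp only [Fin.init, Y]
    cases i using Fin.cases with
    | zero =>
      change c (pt t, qt t) = c (p, q)
      simp only [c, hpt t _ h0last, hqt t _ h0last]
    | succ k =>
      rw [← Fin.succ_castSucc, Fin.cons_succ, Fin.cons_succ, hqt t _ (hcs k)]
  have hμ1 : ∀ i : ℕ, ∀ hi : i < 2 * μ, (⟨i, by omega⟩ : Fin (2 * μ + 1)) ≠ last := by
    intro i hi h0
    have := congrArg Fin.val h0
    simp [hlast] at this
    omega
  have hidx : ∀ i : ℕ, ∀ hi : i + 1 < 2 * μ + 1 + 1, ∀ z : ℂ, ∀ w : Fin (2 * μ + 1) → ℂ,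
      (Fin.cons z w : Fin (2 * μ + 1 + 1) → ℂ) ⟨i + 1, hi⟩ = w ⟨i, by omega⟩ :=
    fun i hi z w => Fin.cons_succ (α := fun _ => ℂ) z w ⟨i, by omega⟩
  have hcurve : Tendsto (fun t => (pt t, qt t)) (𝓝 0) (𝓝 (p, q)) := by
    have : Continuous fun t => (pt t, qt t) := by fun_prop
    simpa [pt, qt] using this.tendsto 0
  -- Only the two upper windows depend on `t`; `A` and `B` are the terms with the lower ones.
  set A := h 0 0 (Fin.init (X (p, q))) * (p ⟨μ, by omega⟩ + 1) with hA
  set B := h 0 0 (Fin.init (Y (p, q))) * (q ⟨μ, by omega⟩ - 1) with hB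
  have hconst : (fun t => A + h 0 0 (pt t) * (p ⟨μ - 1, by omega⟩ - 1) -
      β * (B + h 0 0 (qt t) * (q ⟨μ - 1, by omega⟩ + 1))) =ᶠ[𝓝 0] fun _ => 0 := by
    filter_upwards [hcurve.eventually hpq] with t ht
    have hlXY : Linked 1 β (X (pt t, qt t)) (Y (pt t, qt t)) := by
      intro k
      cases k using Fin.cases with
      | zero =>
        have : qt t 0 - 1 ≠ 0 := by
          have := (ht.2.2.2.1 (Fin.succ 0)).1
          simp only [Y, Fin.cons_succ] at this
          exact sub_ne_zero.2 this
        simp only [X, Y, Fin.cons_succ, Fin.castSucc_zero, Fin.cons_zero, c]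
        field_simp
        ring
      | succ k =>
        simp only [X, Y, Fin.cons_succ, ← Fin.succ_castSucc]
        exact hlt t k
    have := hc.compat_of_linked hβ ha hlXY ht.2.2.1 ht.2.2.2.1 ht.2.2.2.2.1 ht.1
      ht.2.2.2.2.2 ht.2.1
    rw [hXi, hYi] at this
    obtain ⟨ν, rfl⟩ : ∃ ν, μ = ν + 1 := ⟨μ - 1, by omega⟩
    simp only [X, Y, hidx, Fin.tail_cons] at this
    rw [hpt t _ (hμ1 _ (by omega)), hqt t _ (hμ1 _ (by omega)),
      hpt t _ (hμ1 _ (by omega)), hqt t _ (hμ1 _ (by omega))] at this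
    exact this
  have hdiff : ∀ z ∈ D 0 0, DifferentiableAt ℂ (h 0 0) z := fun z hz =>
    (hc.holomorphic 0 0).differentiableAt (hD.mem_nhds hz)
  have d1 := hasDerivAt_comp_line (hdiff p hpq0.1) (Pi.single last a)
  have d2 := hasDerivAt_comp_line (hdiff q hpq0.2.1) (Pi.single last b)
  have d3 := ((d1.mul_const (p ⟨μ - 1, by omega⟩ - 1)).const_add A).sub
    (((d2.mul_const (q ⟨μ - 1, by omega⟩ + 1)).const_add B).const_mul β)
  have d4 := d3.unique ((hasDerivAt_const (0 : ℂ) (0 : ℂ)).congr_of_eventuallyEq hconst)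
  have hs : ∀ s : ℂ, (Pi.single last s : Fin (2 * μ + 1) → ℂ) = s • Pi.single last 1 := fun s => by
    rw [← Pi.single_smul', smul_eq_mul, mul_one]
  rw [hs a, hs b, map_smul, map_smul, smul_eq_mul, smul_eq_mul, ha', hb'] at d4
  apply mul_left_cancel₀ hβ
  linear_combination d4

end Nonexistence

/-! ### Absence of autonomous symmetries of low order -/

/-- In its uses, `P` is the product of `u ^ 2 - 1` over the `μ` entries from the centre of the
window to the last but one. The hypothesis `hPl` says that the relation of
`IsCompatibleM.eventually_fderiv_last` becomes `β ^ μ * g p = g q` for `g = (∂h/∂u_{n,m+μ}) / P`. -/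
theorem IsGeneralizedSymmetryM.false_of_invariants {β : ℂ} {μ : ℕ}
    {D : ℤ → ℤ → Set (Fin (2 * μ + 1) → ℂ)} {h : ℤ → ℤ → (Fin (2 * μ + 1) → ℂ) → ℂ}
    (hβ : β ≠ 0) (hβμ : β ^ μ ≠ 1) (hs : IsGeneralizedSymmetryM (betaEquation β) μ D h)
    (ha : IsAutonomous D h) (hinv : HasOnlyConstantInvariants (2 * μ))
    {P : (Fin (2 * μ + 1) → ℂ) → ℂ} (hP : Differentiable ℂ P)
    (hP0 : ∀ p, (∀ i, p i ≠ 1 ∧ p i ≠ -1) → P p ≠ 0)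
    (hPl : ∀ p q, Linked 1 β p q → (∀ i, q i ≠ 1 ∧ q i ≠ -1) → ∀ a b : ℂ,
      a * (p ⟨μ - 1, by omega⟩ - 1) * (q ⟨2 * μ - 1, by omega⟩ + 1) =
        b * (q ⟨μ - 1, by omega⟩ + 1) * (p ⟨2 * μ - 1, by omega⟩ - 1) →
      β ^ μ * a * P q = b * P p) : False := by
  have hc := hs.isCompatible
  obtain ⟨x, y, hxy, hx, hy, hx0, hx1, hy0, hy1⟩ := hc.exists_linked hβ ha
  have hD := hc.isOpen 0 0
  have hreg : ∀ {x : Fin (2 * μ + 1) → ℂ}, (∀ i, x i ≠ 1 ∧ x i ≠ -1) →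
      ∀ᶠ p in 𝓝 x, ∀ i, p i ≠ 1 ∧ p i ≠ -1 := fun {x} hx => eventually_all.2 fun i =>
    ((continuous_apply i).continuousAt.eventually_ne (hx i).1).and
      ((continuous_apply i).continuousAt.eventually_ne (hx i).2)
  have hrx : ∀ i, Fin.tail x i ≠ 1 ∧ Fin.tail x i ≠ -1 := fun i => hx _
  have hry : ∀ i, Fin.tail y i ≠ 1 ∧ Fin.tail y i ≠ -1 := fun i => hy _
  have hev := hc.eventually_fderiv_last hβ hs.pos ha hxy hx hy hx0 hx1 hy0 hy1
  have hzero := eqOn_zero_of_linked (H := fun p => fderiv ℂ (h 0 0) p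
      (Pi.single (Fin.last (2 * μ)) 1)) hinv hβ (pow_ne_zero μ hβ) hβμ hD
    (hc.isConnected 0 0).isPreconnected
    ((hc.holomorphic 0 0).fderiv_apply_const hD _) hP hP0 hx1 hy1 hrx hry (fun k => hxy k.succ) (by
      filter_upwards [hev, continuous_fst.continuousAt.eventually (hreg hrx),
        continuous_snd.continuousAt.eventually (hreg hry)] with pq h1 h2 h3 h4
      have := hPl _ _ h4 h3 _ _ (h1 h4)
      have hp := hP0 _ h2
      have hq := hP0 _ h3
      field_simp
      linear_combination this)
  obtain ⟨n, m, z, hz, hne⟩ := hs.depends_top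
  apply hne
  rw [(ha n m).1] at hz
  have hcont : Tendsto (Function.update z (Fin.last (2 * μ))) (𝓝 (z (Fin.last (2 * μ)))) (𝓝 z) := by
    have : Continuous (Function.update z (Fin.last (2 * μ))) := by fun_prop
    simpa using this.tendsto (z (Fin.last (2 * μ)))
  have heq : (fun t => h n m (Function.update z (Fin.last (2 * μ)) t)) =ᶠ[𝓝 (z (Fin.last (2 * μ)))]
      fun t => h 0 0 (Function.update z (Fin.last (2 * μ)) t) :=
    (hcont.eventually (hD.mem_nhds hz)).mono fun t ht => (ha n m).2 ht
  have hd : HasFDerivAt (h 0 0) (fderiv ℂ (h 0 0) z)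
      (Function.update z (Fin.last (2 * μ)) (z (Fin.last (2 * μ)))) := by
    rw [Function.update_eq_self]
    exact ((hc.holomorphic 0 0).differentiableAt (hD.mem_nhds hz)).hasFDerivAt
  rw [partialDeriv, heq.deriv_eq]
  exact (hd.comp_hasDerivAt _ (hasDerivAt_update z (Fin.last (2 * μ)) _)).deriv.trans (hzero hz)

theorem IsGeneralizedSymmetryM.not_isAutonomous_one {β : ℂ} (hβ : β ≠ 0) (hβ1 : β ≠ 1)
    {D : ℤ → ℤ → Set (Fin (2 * 1 + 1) → ℂ)} {h : ℤ → ℤ → (Fin (2 * 1 + 1) → ℂ) → ℂ}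
    (hs : IsGeneralizedSymmetryM (betaEquation β) 1 D h) : ¬ IsAutonomous D h := by
  intro ha
  refine hs.false_of_invariants hβ (by rwa [pow_one]) ha hasOnlyConstantInvariants_two
    (P := fun p => (p 1 - 1) * (p 1 + 1)) (by fun_prop) (fun p hp => ?_) fun p q hl hq a b hab => ?_
  · exact mul_ne_zero (sub_ne_zero.2 (hp 1).1) fun h => (hp 1).2 (eq_neg_of_add_eq_zero_left h)
  · have h0 : (p 1 + 1) * (p 0 - 1) = β * ((q 1 - 1) * (q 0 + 1)) := hl 0
    change a * (p 0 - 1) * (q 1 + 1) = b * (q 0 + 1) * (p 1 - 1) at hab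
    have hne : q 0 + 1 ≠ 0 := fun h => (hq 0).2 (eq_neg_of_add_eq_zero_left h)
    apply mul_left_cancel₀ hne
    linear_combination (p 1 + 1) * hab - a * (q 1 + 1) * h0

theorem IsGeneralizedSymmetryM.not_isAutonomous_two {β : ℂ} (hβ : β ≠ 0) (hβ2 : β ^ 2 ≠ 1)
    {D : ℤ → ℤ → Set (Fin (2 * 2 + 1) → ℂ)} {h : ℤ → ℤ → (Fin (2 * 2 + 1) → ℂ) → ℂ}
    (hs : IsGeneralizedSymmetryM (betaEquation β) 2 D h) : ¬ IsAutonomous D h := by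
  intro ha
  refine hs.false_of_invariants hβ hβ2 ha hasOnlyConstantInvariants_four
    (P := fun p => (p 2 - 1) * (p 2 + 1) * ((p 3 - 1) * (p 3 + 1))) (by fun_prop)
    (fun p hp => ?_) fun p q hl hq a b hab => ?_
  · have hne : ∀ i, (p i - 1) * (p i + 1) ≠ 0 := fun i =>
      mul_ne_zero (sub_ne_zero.2 (hp i).1) fun h => (hp i).2 (eq_neg_of_add_eq_zero_left h)
    exact mul_ne_zero (hne 2) (hne 3)
  · have h1 : (p 2 + 1) * (p 1 - 1) = β * ((q 2 - 1) * (q 1 + 1)) := hl 1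
    have h2 : (p 3 + 1) * (p 2 - 1) = β * ((q 3 - 1) * (q 2 + 1)) := hl 2
    change a * (p 1 - 1) * (q 3 + 1) = b * (q 1 + 1) * (p 3 - 1) at hab
    have hne : q 1 + 1 ≠ 0 := fun h => (hq 1).2 (eq_neg_of_add_eq_zero_left h)
    apply mul_left_cancel₀ hne
    linear_combination (p 2 + 1) * (p 3 + 1) * (p 2 - 1) * hab
      - a * (q 3 + 1) * (p 3 + 1) * (p 2 - 1) * h1
      - a * (q 3 + 1) * β * ((q 2 - 1) * (q 1 + 1)) * h2

/-! ### Modified Volterra flows -/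

/-- A solution independent of `m`, with `u n m ^ 2 - 1 = β ^ (-n)`. -/
theorem exists_betaEquation_isRegularSolution {β : ℂ} (hβ : β ≠ 0) :
    ∃ u, (betaEquation β).IsRegularSolution u := by
  have h : ∀ n : ℤ, ∃ a : ℂ, a ^ 2 = 1 + β ^ (-n) := fun n =>
    IsAlgClosed.exists_pow_nat_eq _ two_pos
  choose a ha using h
  refine ⟨fun n _ => a n, (betaEquation_isRegularSolution_iff hβ).2 ⟨fun n m => ?_, fun n m => ?_⟩⟩
  · have h1 : β * β ^ (-(n + 1)) = β ^ (-n) := by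
      rw [← zpow_one_add₀ hβ]; congr 1; ring
    simp only [betaEquation]
    linear_combination ha n - β * ha (n + 1) - h1
  · have h0 : β ^ (-n) ≠ 0 := zpow_ne_zero _ hβ
    exact ⟨fun h => h0 (by linear_combination -ha n + (a n + 1) * h),
      fun h => h0 (by linear_combination -ha n + (a n - 1) * h)⟩

theorem isGeneralizedSymmetryM_univ {β : ℂ} (hβ : β ≠ 0) {μ : ℕ} (hμ : 0 < μ)
    {f : (Fin (2 * μ + 1) → ℂ) → ℂ} (hf : Differentiable ℂ f)
    (hc : ∀ u, (betaEquation β).IsSolution u → ∀ n m : ℤ,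
      f (mWindow μ u n m) * (u n (m + 1) + 1) + f (mWindow μ u n (m + 1)) * (u n m - 1) =
        β * (f (mWindow μ u (n + 1) m) * (u (n + 1) (m + 1) - 1) +
          f (mWindow μ u (n + 1) (m + 1)) * (u (n + 1) m + 1)))
    (htop : partialDeriv f (Fin.last (2 * μ)) 0 ≠ 0) (hbot : partialDeriv f 0 0 ≠ 0) :
    IsGeneralizedSymmetryM (betaEquation β) μ (fun _ _ => univ) (fun _ _ => f) where
  pos := hμ
  isCompatible :=
    { isOpen := fun _ _ => isOpen_univ
      isConnected := fun _ _ => isConnected_univ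
      holomorphic := fun _ _ => hf.differentiableOn
      nonvoid := fun n m => by
        obtain ⟨u, hu⟩ := exists_betaEquation_isRegularSolution hβ
        exact ⟨u, hu, trivial, trivial, trivial, trivial⟩
      compatible := fun u hu n m _ => by
        rw [betaEquation_d00, betaEquation_d01, betaEquation_d10, betaEquation_d11]
        linear_combination hc u hu n m }
  depends_top := ⟨0, 0, 0, trivial, htop⟩
  depends_bottom := ⟨0, 0, 0, trivial, hbot⟩

/-- The second Volterra flow at site `0`. -/
def volterra₂ (w : ℤ → ℂ) : ℂ :=
  w 0 * (w 1 * (w 2 + w 1 + w 0) - w (-1) * (w 0 + w (-1) + w (-2)))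

/-- The second modified Volterra flow at site `0`, with the multiple of the first flow for which the
Miura map leads to `volterra₂` alone. -/
def mVolterra₂ (x : ℤ → ℂ) : ℂ :=
  (x 0 ^ 2 - 1) * ((x 1 ^ 2 - 1) * (x 2 + x 0) - (x (-1) ^ 2 - 1) * (x 0 + x (-2))
    - 4 * (x 1 - x (-1)))

/-- The sum over closed walks of length six on `ℤ` starting at `k`, in which a step up to `j` has
weight `w j`: a diagonal entry of the sixth power of the Lax operator. -/
def volterraDensity₃ (w : ℤ → ℂ) (k : ℤ) : ℂ :=
  w k ^ 3 + 3 * w k ^ 2 * w (k + 1) + 3 * w k * w (k + 1) ^ 2 + w (k + 1) ^ 3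
    + 2 * w (k + 1) ^ 2 * w (k + 2) + 2 * w k * w (k + 1) * w (k + 2)
    + 2 * w (k - 1) * w k * w (k + 1) + 2 * w (k - 1) * w k ^ 2
    + w (k + 1) * w (k + 2) * w (k + 3) + w (k + 1) * w (k + 2) ^ 2
    + w (k - 1) ^ 2 * w k + w (k - 2) * w (k - 1) * w k

/-- The third Volterra flow at site `0`. -/
def volterra₃ (w : ℤ → ℂ) : ℂ := w 0 * (volterraDensity₃ w 0 - volterraDensity₃ w (-1))

/-- The upward half of the third modified Volterra flow, without the factor at the centre `b`. The
entries are at the sites `-1, 0, 1, 2, 3`. -/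
def mVolterraHalf₃ (a b c d e : ℂ) : ℂ :=
  (c ^ 2 - 1) * (a * b ^ 2 + b ^ 2 * c + 2 * b * c * d + c * d ^ 2 + d ^ 2 * e
    - a - 6 * b - 6 * d - e)

/-- The third modified Volterra flow at site `0`, with the multiples of lower flows for which the
Miura map leads to `volterra₃` alone. -/
def mVolterra₃ (x : ℤ → ℂ) : ℂ :=
  (x 0 ^ 2 - 1) * (mVolterraHalf₃ (x (-1)) (x 0) (x 1) (x 2) (x 3)
    - mVolterraHalf₃ (x 1) (x 0) (x (-1)) (x (-2)) (x (-3)) + 16 * (x 1 - x (-1)))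

theorem mVolterra₂_miura (x : ℤ → ℂ) :
    mVolterra₂ x * (x 1 + 1) + mVolterra₂ (fun k => x (k + 1)) * (x 0 - 1) =
      volterra₂ fun k => (x (k + 1) + 1) * (x k - 1) := by
  simp only [mVolterra₂, volterra₂]
  norm_num
  ring

theorem mVolterra₃_miura (x : ℤ → ℂ) :
    mVolterra₃ x * (x 1 + 1) + mVolterra₃ (fun k => x (k + 1)) * (x 0 - 1) =
      volterra₃ fun k => (x (k + 1) + 1) * (x k - 1) := by
  simp only [mVolterra₃, volterra₃, mVolterraHalf₃, volterraDensity₃]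
  norm_num
  ring

/-! ### Existence of the symmetry of order `N` -/

/-- If the Miura map sends the odd flow `F` to `P`, and `P (β w) = β P w`, then `F` is compatible
with the discrete equation. Oddness of `F` gives the second Miura map from the first by `y ↦ -y`. -/
theorem isSolution_flow_identity {β : ℂ} {F P : (ℤ → ℂ) → ℂ} (hodd : ∀ x, F (-x) = -F x)
    (hP : ∀ w, P (β • w) = β * P w)
    (hF : ∀ x, F x * (x 1 + 1) + F (fun k => x (k + 1)) * (x 0 - 1) =
      P fun k => (x (k + 1) + 1) * (x k - 1))
    {u : ℤ → ℤ → ℂ} (hu : (betaEquation β).IsSolution u) (n m : ℤ) :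
    F (fun k => u n (m + k)) * (u n (m + 1) + 1) + F (fun k => u n (m + 1 + k)) * (u n m - 1) =
      β * (F (fun k => u (n + 1) (m + k)) * (u (n + 1) (m + 1) - 1) +
        F (fun k => u (n + 1) (m + 1 + k)) * (u (n + 1) m + 1)) := by
  have hs : ∀ n, (fun k => u n (m + (k + 1))) = fun k => u n (m + 1 + k) := fun n => by
    ext k; congr 1; ring
  have h1 := hF fun k => u n (m + k)
  have h2 := hF (-fun k => u (n + 1) (m + k))
  have h3 : (fun k => (-fun k => u (n + 1) (m + k)) (k + 1)) =
      -fun k => u (n + 1) (m + 1 + k) := by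
    rw [← hs (n + 1)]; rfl
  have h4 : (fun k => (u n (m + (k + 1)) + 1) * (u n (m + k) - 1)) =
      β • fun k => ((-fun k => u (n + 1) (m + k)) (k + 1) + 1) *
        ((-fun k => u (n + 1) (m + k)) k - 1) := by
    ext k
    have := sub_eq_zero.1 (hu n (m + k))
    simp only [Pi.smul_apply, Pi.neg_apply, smul_eq_mul]
    rw [← add_assoc, this]
    ring
  rw [h4, hP, ← h2, h3, hodd, hodd, hs n] at h1
  simp only [Pi.neg_apply, add_zero] at h1
  linear_combination h1

theorem mVolterra₂_neg (x : ℤ → ℂ) : mVolterra₂ (-x) = -mVolterra₂ x := by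
  simp only [mVolterra₂, Pi.neg_apply]
  ring

theorem mVolterra₃_neg (x : ℤ → ℂ) : mVolterra₃ (-x) = -mVolterra₃ x := by
  simp only [mVolterra₃, mVolterraHalf₃, Pi.neg_apply]
  ring

theorem volterra₂_smul {β : ℂ} (hβ : β ^ 2 = 1) (w : ℤ → ℂ) :
    volterra₂ (β • w) = β * volterra₂ w := by
  have : volterra₂ (β • w) = β ^ 2 * β * volterra₂ w := by
    simp only [volterra₂, Pi.smul_apply, smul_eq_mul]
    ring
  rw [this, hβ, one_mul]

theorem volterra₃_smul {β : ℂ} (hβ : β ^ 3 = 1) (w : ℤ → ℂ) :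
    volterra₃ (β • w) = β * volterra₃ w := by
  have : volterra₃ (β • w) = β ^ 3 * β * volterra₃ w := by
    simp only [volterra₃, volterraDensity₃, Pi.smul_apply, smul_eq_mul]
    ring
  rw [this, hβ, one_mul]

/-- The entry of a window at the site `k`, counted from the centre; meaningful for `|k| ≤ μ`. -/
def unwindow {μ : ℕ} (x : Fin (2 * μ + 1) → ℂ) (k : ℤ) : ℂ :=
  x (Fin.ofNat (2 * μ + 1) (k + μ).toNat)

theorem unwindow_mWindow {μ : ℕ} (u : ℤ → ℤ → ℂ) (n m : ℤ) {k : ℤ} (h1 : -(μ : ℤ) ≤ k)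
    (h2 : k ≤ μ) : unwindow (mWindow μ u n m) k = u n (m + k) := by
  simp only [unwindow, mWindow, Fin.val_ofNat]
  rw [Nat.mod_eq_of_lt (by omega)]
  congr 1
  omega

theorem isGeneralizedSymmetryM_mVolterra₂ {β : ℂ} (hβ : β ^ 2 = 1) :
    IsGeneralizedSymmetryM (betaEquation β) 2 (fun _ _ => univ)
      (fun _ _ x => mVolterra₂ (unwindow x)) := by
  have hβ0 : β ≠ 0 := by rintro rfl; norm_num at hβ
  refine isGeneralizedSymmetryM_univ hβ0 two_pos ?_ (fun u hu n m => ?_) ?_ ?_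
  · simp only [mVolterra₂, unwindow]
    fun_prop
  · have hw : ∀ n m, mVolterra₂ (unwindow (mWindow 2 u n m)) = mVolterra₂ fun k => u n (m + k) := by
      intro n m
      simp (disch := norm_num) only [mVolterra₂, unwindow_mWindow]
    simp only [hw]
    exact isSolution_flow_identity mVolterra₂_neg (volterra₂_smul hβ) mVolterra₂_miura hu n m
  · have : (fun z : ℂ => mVolterra₂ (unwindow (Function.update (0 : Fin (2 * 2 + 1) → ℂ)
        (Fin.last (2 * 2)) z))) = fun z => z := by
      ext z
      simp [mVolterra₂, unwindow, Fin.ext_iff]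
    rw [partialDeriv, this]
    simp
  · have : (fun z : ℂ => mVolterra₂ (unwindow (Function.update (0 : Fin (2 * 2 + 1) → ℂ)
        0 z))) = fun z => -z := by
      ext z
      simp [mVolterra₂, unwindow, Fin.ext_iff]
    rw [partialDeriv, this]
    simp

theorem isGeneralizedSymmetryM_mVolterra₃ {β : ℂ} (hβ : β ^ 3 = 1) :
    IsGeneralizedSymmetryM (betaEquation β) 3 (fun _ _ => univ)
      (fun _ _ x => mVolterra₃ (unwindow x)) := by
  have hβ0 : β ≠ 0 := by rintro rfl; norm_num at hβ
  refine isGeneralizedSymmetryM_univ hβ0 three_pos ?_ (fun u hu n m => ?_) ?_ ?_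
  · simp only [mVolterra₃, mVolterraHalf₃, unwindow]
    fun_prop
  · have hw : ∀ n m, mVolterra₃ (unwindow (mWindow 3 u n m)) = mVolterra₃ fun k => u n (m + k) := by
      intro n m
      simp (disch := norm_num) only [mVolterra₃, unwindow_mWindow]
    simp only [hw]
    exact isSolution_flow_identity mVolterra₃_neg (volterra₃_smul hβ) mVolterra₃_miura hu n m
  · have : (fun z : ℂ => mVolterra₃ (unwindow (Function.update (0 : Fin (2 * 3 + 1) → ℂ)
        (Fin.last (2 * 3)) z))) = fun z => -z := by
      ext z
      simp [mVolterra₃, mVolterraHalf₃, unwindow, Fin.ext_iff]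
    rw [partialDeriv, this]
    simp
  · have : (fun z : ℂ => mVolterra₃ (unwindow (Function.update (0 : Fin (2 * 3 + 1) → ℂ)
        0 z))) = fun z => z := by
      ext z
      simp [mVolterra₃, mVolterraHalf₃, unwindow, Fin.ext_iff]
    rw [partialDeriv, this]
    simp

theorem mainTheorem7 (N : ℕ) (hN : N = 2 ∨ N = 3) (β : ℂ) (hβ : IsPrimitiveRoot β N) :
    (∃ (D : ℤ → ℤ → Set (Fin (2 * N + 1) → ℂ)) (h : ℤ → ℤ → (Fin (2 * N + 1) → ℂ) → ℂ),
      IsGeneralizedSymmetryM (betaEquation β) N D h ∧ IsAutonomous D h ∧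
        ∀ n m : ℤ, D n m = Set.univ) ∧
    ∀ μ : ℕ, μ < N →
      ¬ ∃ (D : ℤ → ℤ → Set (Fin (2 * μ + 1) → ℂ)) (h : ℤ → ℤ → (Fin (2 * μ + 1) → ℂ) → ℂ),
        IsGeneralizedSymmetryM (betaEquation β) μ D h ∧ IsAutonomous D h := by
  have hβ0 : β ≠ 0 := hβ.ne_zero (by omega)
  constructor
  · rcases hN with rfl | rfl
    · exact ⟨_, _, isGeneralizedSymmetryM_mVolterra₂ hβ.pow_eq_one,
        fun _ _ => ⟨rfl, fun _ _ => rfl⟩, fun _ _ => rfl⟩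
    · exact ⟨_, _, isGeneralizedSymmetryM_mVolterra₃ hβ.pow_eq_one,
        fun _ _ => ⟨rfl, fun _ _ => rfl⟩, fun _ _ => rfl⟩
  · rintro μ hμN ⟨D, h, hs, ha⟩
    have hμ := hs.pos
    have hpow := hβ.pow_ne_one_of_pos_of_lt hμ.ne' hμN
    obtain rfl | rfl : μ = 1 ∨ μ = 2 := by omega
    · exact hs.not_isAutonomous_one hβ0 (by simpa using hpow) ha
    · exact hs.not_isAutonomous_two hβ0 hpow ha
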